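/- Matrices carry the operator norm between Euclidean spaces. Let $\mathbf A=(A_1,A_2)$ be a pair of complex $2\times 2$ matrices and put $\|(z_1,z_2)\|_{\mathbf A}=\|z_1A_1+z_2A_2\|$ and $\Omega_{\mathbf A}=\{z\in\mathbb C^2:\|z\|_{\mathbf A}<1\}$. Call $A_1,A_2$ *simultaneously diagonalizable* if there are unitary matrices $U,W$ such that $UA_1W$ and $UA_2W$ are both diagonal. Let $\mathcal O(\Omega_{\mathbf A})$ be the algebra of functions holomorphic on some open set containing $\{z:\|z\|_{\mathbf A}\le 1\}$, and for a $k\times k$ matrix $F=(F_{ij})$ of such functions put $\|F\|_\infty=\sup_{z\in\Omega_{\mathbf A}}\|(F_{ij}(z))\|$. A unital algebra homomorphism $\rho:\mathcal O(\Omega_{\mathbf A})\to B(\mathcal H)$ ($\mathcal H$ a complex Hilbert space) is *contractive* if $\|\rho(f)\|\le\|f\|_\infty$ for all $f$, and *completely contractive* if for every $k\ge1$ its amplification $\rho^{(k)}(F)=(\rho(F_{ij}))_{i,j}\in B(\mathcal H^k)$ satisfies $\|\rho^{(k)}(F)\|\le\|F\|_\infty$ for all $k\times k$ matrices $F$. For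 a pair $\mathbf V=(V_1,V_2)$ of complex $p\times q$ matrices let $$\rho_{\mathbf V}(f)=\begin{pmatrix} f(0)I_p&\partial_1f(0)V_1+\partial_2f(0)V_2\\0&f(0)I_q\end{pmatrix}.$$ For $k\ge1$ and $k\times k$ matrices $\Theta_1,\Theta_2$ let $$L^{(k)}_{\mathbf V}(\Theta_1,\Theta_2)=\Theta_1\otimes V_1+\Theta_2\otimes V_2,\qquad \|(\Theta_1,\Theta_2)\|^*_{\mathbf A,k}=\sup_{z\in\Omega_{\mathbf A}}\|z_1\Theta_1+z_2\Theta_2\|;$$ for $k=1$ these are $L_{\mathbf V}(w)=w_1V_1+w_2V_2$ and the dual norm $\|w\|^*_{\mathbf A}=\sup_{z\in\Omega_{\mathbf A}}|w_1z_1+w_2z_2|$ on $\mathbb C^2$. The map $L_{\mathbf V}$ is *contractive* if $\|L_{\mathbf V}(w)\|\le\|w\|_{\mathbf A}^*$ for all $w$, and *completely contractive* if, for every $k\ge 1$, $\|L_{\mathbf V}^{(k)}(\Theta)\|\le\|\Theta\|^*_{\mathbf A,k}$ for all $\Theta$. 1. If $A_1,A_2$ are not simultaneously diagonalizable, then there are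 $p,q$ and $p\times q$ matrices $V_1,V_2$ such that $\rho_{\mathbf V}$ is contractive but not completely contractive on $\mathcal O(\Omega_{\mathbf A})$, and the linear map $L_{\mathbf V}$ on $(\mathbb C^2,\|\cdot\|^*_{\mathbf A})$ is contractive but not completely contractive. 2. If $A_1,A_2$ are linearly independent (that is, $\|\cdot\|_{\mathbf A}$ is a norm), then for all $p,q$ and all $\mathbf V$: $\rho_{\mathbf V}$ is contractive if and only if $L_{\mathbf V}$ is; for each $k\ge1$, $\rho^{(k)}_{\mathbf V}$ is contractive if and only if $L^{(k)}_{\mathbf V}$ is; and so $\rho_{\mathbf V}$ is completely contractive if and only if $L_{\mathbf V}$ is. 3. If $A_1,A_2$ are linearly independent and simultaneously diagonalizable, then an invertible linear map of $\mathbb C^2$ carries the bidisc $\{z:|z_1|<1,|z_2|<1\}$ onto $\Omega_{\mathbf A}$, and every contractive unital homomorphism $\rho:\mathcal O(\Omega_{\mathbf A})\to B(\mathcal H)$, for every complex Hilbert space $\mathcal H$, is completely contractive. In particular, for all $p,q$ and all $\mathbf V$, if $\rho_{\mathbf V}$ (respectively $L_{\mathbf V}$) is contractive, then it is completely contractive.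 -/

import Mathlib

open scoped Matrix.Norms.L2Operator Kronecker ENNReal

namespace BallHom

/-- `‖z‖_A = ‖z₁ A₁ + z₂ A₂‖`, where the norm on matrices is the operator norm
between Euclidean spaces (the norm on `Matrix` throughout this file). -/
noncomputable def normA (A : Fin 2 → Matrix (Fin 2) (Fin 2) ℂ) (z : Fin 2 → ℂ) : ℝ :=
  ‖∑ i, z i • A i‖

/-- The open unit ball `Ω_A` of `‖·‖_A`. -/
def unitBall (A : Fin 2 → Matrix (Fin 2) (Fin 2) ℂ) : Set (Fin 2 → ℂ) :=
  {z | normA A z < 1}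

/-- The closed unit ball of `‖·‖_A`. -/
def closedUnitBall (A : Fin 2 → Matrix (Fin 2) (Fin 2) ℂ) : Set (Fin 2 → ℂ) :=
  {z | normA A z ≤ 1}

/-- Simultaneous diagonalizability up to unitary equivalence: there are unitary matrices
`U`, `W` such that `U A₁ W` and `U A₂ W` are both diagonal. -/
def SimultaneouslyDiagonalizable (A : Fin 2 → Matrix (Fin 2) (Fin 2) ℂ) : Prop :=
  ∃ U ∈ Matrix.unitaryGroup (Fin 2) ℂ, ∃ W ∈ Matrix.unitaryGroup (Fin 2) ℂ,
    ∀ i, (U * A i * W).IsDiag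

/-- The algebra `𝒪(Ω_A)` of functions holomorphic on some open set containing the closed unit
ball. The values outside that open set are irrelevant: every map below that is contractive for
the supremum over `Ω_A` ignores them. -/
def holo (A : Fin 2 → Matrix (Fin 2) (Fin 2) ℂ) : Subalgebra ℂ ((Fin 2 → ℂ) → ℂ) where
  carrier := {f | ∃ U : Set (Fin 2 → ℂ), IsOpen U ∧ closedUnitBall A ⊆ U ∧ DifferentiableOn ℂ f U}
  mul_mem' := by
    rintro f g ⟨U, hU, hAU, hf⟩ ⟨W, hW, hAW, hg⟩
    exact ⟨U ∩ W, hU.inter hW, Set.subset_inter hAU hAW,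
      (hf.mono Set.inter_subset_left).mul (hg.mono Set.inter_subset_right)⟩
  add_mem' := by
    rintro f g ⟨U, hU, hAU, hf⟩ ⟨W, hW, hAW, hg⟩
    exact ⟨U ∩ W, hU.inter hW, Set.subset_inter hAU hAW,
      (hf.mono Set.inter_subset_left).add (hg.mono Set.inter_subset_right)⟩
  algebraMap_mem' := fun c =>
    ⟨Set.univ, isOpen_univ, Set.subset_univ _, differentiableOn_const c⟩

theorem holo_differentiableAt_zero {A : Fin 2 → Matrix (Fin 2) (Fin 2) ℂ} (f : holo A) :
    DifferentiableAt ℂ (f : (Fin 2 → ℂ) → ℂ) 0 := by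
  obtain ⟨U, hU, hAU, hf⟩ := f.2
  exact hf.differentiableAt (hU.mem_nhds (hAU (by simp [closedUnitBall, normA])))

/-- The partial derivative `∂ᵢ f(0)`. -/
noncomputable def partialZero (f : (Fin 2 → ℂ) → ℂ) (i : Fin 2) : ℂ :=
  fderiv ℂ f 0 (Pi.single i 1)

/-- The matrix `ρ_V(f)` with blocks `f(0) I_p`, `∑ ∂ᵢ f(0) Vᵢ`, `0`, `f(0) I_q`. -/
noncomputable def rhoMatrix {p q : ℕ} (V : Fin 2 → Matrix (Fin p) (Fin q) ℂ)
    (f : (Fin 2 → ℂ) → ℂ) : Matrix (Fin p ⊕ Fin q) (Fin p ⊕ Fin q) ℂ :=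
  Matrix.fromBlocks (f 0 • (1 : Matrix (Fin p) (Fin p) ℂ)) (∑ i, partialZero f i • V i)
    0 (f 0 • (1 : Matrix (Fin q) (Fin q) ℂ))

/-- `ρ_V` as a homomorphism of algebras into the matrices of size `p + q`. -/
noncomputable def rhoMatrixHom (A : Fin 2 → Matrix (Fin 2) (Fin 2) ℂ) {p q : ℕ}
    (V : Fin 2 → Matrix (Fin p) (Fin q) ℂ) :
    holo A →ₐ[ℂ] Matrix (Fin p ⊕ Fin q) (Fin p ⊕ Fin q) ℂ :=
  AlgHom.ofLinearMap
    { toFun := fun f => rhoMatrix V f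
      map_add' := fun f g => by
        have h : ∀ i, partialZero ((f : (Fin 2 → ℂ) → ℂ) + (g : (Fin 2 → ℂ) → ℂ)) i
            = partialZero f i + partialZero g i := fun i => by
          simp only [partialZero]
          rw [fderiv_add (holo_differentiableAt_zero f) (holo_differentiableAt_zero g)]
          rfl
        simp only [rhoMatrix, Subalgebra.coe_add, h, Pi.add_apply, add_smul,
          Finset.sum_add_distrib, Matrix.fromBlocks_add, add_zero]
      map_smul' := fun c f => by
        have h : ∀ i, partialZero (c • (f : (Fin 2 → ℂ) → ℂ)) i = c * partialZero f i :=
          fun i => by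
            simp only [partialZero]
            rw [fderiv_const_smul (holo_differentiableAt_zero f)]
            rfl
        simp only [rhoMatrix, Subalgebra.coe_smul, h, Pi.smul_apply, smul_eq_mul, mul_smul,
          ← Finset.smul_sum, Matrix.fromBlocks_smul, smul_zero, RingHom.id_apply] }
    (by
      have h : ∀ i, partialZero (1 : (Fin 2 → ℂ) → ℂ) i = 0 := fun i => by
        simp only [partialZero]
        rw [show (1 : (Fin 2 → ℂ) → ℂ) = fun _ => 1 from rfl, fderiv_fun_const]
        rfl
      simp [rhoMatrix, h])
    (fun f g => by
      have h : ∀ i, partialZero ((f : (Fin 2 → ℂ) → ℂ) * (g : (Fin 2 → ℂ) → ℂ)) i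
          = (f : (Fin 2 → ℂ) → ℂ) 0 * partialZero g i
            + (g : (Fin 2 → ℂ) → ℂ) 0 * partialZero f i := fun i => by
        simp only [partialZero]
        rw [fderiv_mul (holo_differentiableAt_zero f) (holo_differentiableAt_zero g)]
        rfl
      simp only [LinearMap.coe_mk, AddHom.coe_mk, rhoMatrix, Subalgebra.coe_mul, h,
        Pi.mul_apply, add_smul, Finset.sum_add_distrib, Matrix.fromBlocks_multiply]
      congr 1 <;>
        simp [smul_smul, mul_comm])

/-- `ρ_V` as a homomorphism into the bounded operators on the Hilbert space `ℂ^(p+q)`. -/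
noncomputable def rho (A : Fin 2 → Matrix (Fin 2) (Fin 2) ℂ) {p q : ℕ}
    (V : Fin 2 → Matrix (Fin p) (Fin q) ℂ) :
    holo A →ₐ[ℂ]
      (EuclideanSpace ℂ (Fin p ⊕ Fin q) →L[ℂ] EuclideanSpace ℂ (Fin p ⊕ Fin q)) :=
  (Matrix.toEuclideanCLM (n := Fin p ⊕ Fin q) (𝕜 := ℂ)).toAlgEquiv.toAlgHom.comp
    (rhoMatrixHom A V)

/-- A `k × k` matrix of bounded operators on `H`, as an operator on the Hilbert space `H^k`. -/
noncomputable def blockOp {H : Type*} [NormedAddCommGroup H] [InnerProductSpace ℂ H] {k : ℕ}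
    (T : Matrix (Fin k) (Fin k) (H →L[ℂ] H)) :
    PiLp 2 (fun _ : Fin k => H) →L[ℂ] PiLp 2 (fun _ : Fin k => H) :=
  (PiLp.continuousLinearEquiv 2 ℂ (fun _ : Fin k => H)).symm.toContinuousLinearMap ∘L
    ContinuousLinearMap.pi fun i => ∑ j, T i j ∘L PiLp.proj 2 (fun _ : Fin k => H) j

theorem blockOp_apply {H : Type*} [NormedAddCommGroup H] [InnerProductSpace ℂ H] {k : ℕ}
    (T : Matrix (Fin k) (Fin k) (H →L[ℂ] H)) (x : PiLp 2 (fun _ : Fin k => H)) (i : Fin k) :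
    blockOp T x i = ∑ j, T i j (x j) := by
  simp [blockOp]

/-- The supremum norm over `Ω_A` of a `k × k` matrix of functions. -/
noncomputable def supNorm (A : Fin 2 → Matrix (Fin 2) (Fin 2) ℂ) {k : ℕ}
    (F : Matrix (Fin k) (Fin k) (holo A)) : ℝ≥0∞ :=
  ⨆ z ∈ unitBall A, ‖F.map fun f => (f : (Fin 2 → ℂ) → ℂ) z‖ₑ

/-- `ρ` is contractive: `‖ρ(f)‖ ≤ ‖f‖_∞` for all `f`. -/
def HomContractive {A : Fin 2 → Matrix (Fin 2) (Fin 2) ℂ} {H : Type*} [NormedAddCommGroup H]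
    [InnerProductSpace ℂ H] (ρ : holo A →ₐ[ℂ] (H →L[ℂ] H)) : Prop :=
  ∀ f : holo A, ‖ρ f‖ₑ ≤ ⨆ z ∈ unitBall A, ‖(f : (Fin 2 → ℂ) → ℂ) z‖ₑ

/-- The `k`-th amplification `F = (F_ij) ↦ (ρ(F_ij))` is contractive. -/
def HomContractiveAt {A : Fin 2 → Matrix (Fin 2) (Fin 2) ℂ} {H : Type*} [NormedAddCommGroup H]
    [InnerProductSpace ℂ H] (ρ : holo A →ₐ[ℂ] (H →L[ℂ] H)) (k : ℕ) : Prop :=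
  ∀ F : Matrix (Fin k) (Fin k) (holo A), ‖blockOp (F.map ρ)‖ₑ ≤ supNorm A F

/-- `ρ` is completely contractive. -/
def HomCompletelyContractive {A : Fin 2 → Matrix (Fin 2) (Fin 2) ℂ} {H : Type*}
    [NormedAddCommGroup H] [InnerProductSpace ℂ H] (ρ : holo A →ₐ[ℂ] (H →L[ℂ] H)) : Prop :=
  ∀ k : ℕ, 1 ≤ k → HomContractiveAt ρ k

/-- The dual norm `‖w‖_A^* = sup {|w₁ z₁ + w₂ z₂| : z ∈ Ω_A}`. -/
noncomputable def dualNorm (A : Fin 2 → Matrix (Fin 2) (Fin 2) ℂ) (w : Fin 2 → ℂ) : ℝ≥0∞ :=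
  ⨆ z ∈ unitBall A, ‖∑ i, w i * z i‖ₑ

/-- The norm `‖(Θ₁, Θ₂)‖_{A,k}^* = sup {‖z₁ Θ₁ + z₂ Θ₂‖ : z ∈ Ω_A}` on pairs of `k × k`
matrices: the norm of `(Θ₁, Θ₂)` as a linear map from `(ℂ², ‖·‖_A)` to the matrices. -/
noncomputable def dualNormAt (A : Fin 2 → Matrix (Fin 2) (Fin 2) ℂ) {k : ℕ}
    (Θ : Fin 2 → Matrix (Fin k) (Fin k) ℂ) : ℝ≥0∞ :=
  ⨆ z ∈ unitBall A, ‖∑ i, z i • Θ i‖ₑ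

/-- `L_V(w) = w₁ V₁ + w₂ V₂`. -/
noncomputable def linMap {p q : ℕ} (V : Fin 2 → Matrix (Fin p) (Fin q) ℂ) :
    (Fin 2 → ℂ) →ₗ[ℂ] Matrix (Fin p) (Fin q) ℂ :=
  ∑ i, (LinearMap.proj i : (Fin 2 → ℂ) →ₗ[ℂ] ℂ).smulRight (V i)

theorem linMap_apply {p q : ℕ} (V : Fin 2 → Matrix (Fin p) (Fin q) ℂ) (w : Fin 2 → ℂ) :
    linMap V w = ∑ i, w i • V i := by
  simp [linMap]

/-- `L_V^(k)(Θ₁, Θ₂) = Θ₁ ⊗ V₁ + Θ₂ ⊗ V₂`. -/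
noncomputable def linMapAt {p q k : ℕ} (V : Fin 2 → Matrix (Fin p) (Fin q) ℂ)
    (Θ : Fin 2 → Matrix (Fin k) (Fin k) ℂ) : Matrix (Fin k × Fin p) (Fin k × Fin q) ℂ :=
  ∑ i, Θ i ⊗ₖ V i

/-- `L_V` is contractive on `(ℂ², ‖·‖_A^*)`. -/
def LinContractive (A : Fin 2 → Matrix (Fin 2) (Fin 2) ℂ) {p q : ℕ}
    (V : Fin 2 → Matrix (Fin p) (Fin q) ℂ) : Prop :=
  ∀ w : Fin 2 → ℂ, ‖linMap V w‖ₑ ≤ dualNorm A w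

/-- `L_V^(k)` is contractive for `‖·‖_{A,k}^*`. -/
def LinContractiveAt (A : Fin 2 → Matrix (Fin 2) (Fin 2) ℂ) {p q : ℕ}
    (V : Fin 2 → Matrix (Fin p) (Fin q) ℂ) (k : ℕ) : Prop :=
  ∀ Θ : Fin 2 → Matrix (Fin k) (Fin k) ℂ, ‖linMapAt V Θ‖ₑ ≤ dualNormAt A Θ

/-- `L_V` is completely contractive. -/
def LinCompletelyContractive (A : Fin 2 → Matrix (Fin 2) (Fin 2) ℂ) {p q : ℕ}
    (V : Fin 2 → Matrix (Fin p) (Fin q) ℂ) : Prop :=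
  ∀ k : ℕ, 1 ≤ k → LinContractiveAt A V k

end BallHom

/-! Reduction from `rho` to `linMap`. Let `F` be a matrix of functions of norm less than one on the
ball and put `B = F(0)`. On each disc `ζ ↦ ζ z` the Schwarz lemma says that the block matrix with
diagonal `B, B` and corner `∑ z_l ∂_l F(0)` is a contraction. By a Schur complement there are
matrices `S`, `R`, depending on `B` only, such that a corner `C` is admissible iff `‖S C R‖ ≤ 1`,
and `S ⊗ 1`, `R ⊗ 1` decide the amplified corners in the same way. So `Θ_l = S ∂_l F(0) R` has dual
norm at most one, and contractivity of `L_V^(k)` at this `Θ` is exactly contractivity of `ρ_V^(k)`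
at `F`. This takes the place of moving `F(0)` to the origin by a Möbius map. Conversely, linear
functions turn a bound on `ρ_V^(k)` into one on `L_V^(k)`. See `homContractiveAt_rho_iff`.

A contractive map that is not completely contractive. Some nontrivial combination of `A₁, A₂` is
singular, and unitaries bring it to the matrix unit `E₁₁`. If the pair is not simultaneously
diagonalizable, another combination `M` has zero first entry and a nonzero off-diagonal entry, in
position `(0, 1)` after a transposition. With the combination giving `M` scaled down, the
combinations of the two coefficient vectors whose weights lie in the Euclidean ball have norm at
most one, so by duality the row-valued map `L_V` built from these vectors is contractive. Tested on
`Θ = A`, whose dual norm is at most one by definition, it gives up to unitaries the block row `[E₁₁,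
M]`, with a first row longer than one. See `exists_linContractive_not_linContractiveAt`.

The bidisc. If both matrices are diagonal, `‖·‖_A` is the maximum norm in linear coordinates. A
contractive `ρ` sends the two coordinates to commuting contractions, which by Ando's theorem dilate
to commuting isometries. For these the matrix-valued von Neumann inequality follows from finite
Fourier analysis, one isometry at a time. Polynomial approximation near the closed bidisc passes
from polynomials to all functions. See `HomContractive.homCompletelyContractive`. -/

namespace BallHom

set_option linter.unusedSectionVars false

/-! ### Operator norms of matrices through sums of squares -/

section MatrixNorm

open scoped ComplexOrder

variable {m n m' n' k : Type*} [Fintype m] [Fintype n] [Fintype m'] [Fintype n'] [Fintype k]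
  [DecidableEq m] [DecidableEq n] [DecidableEq m'] [DecidableEq n'] [DecidableEq k]

theorem sum_norm_sq_mulVec_le (M : Matrix m n ℂ) (x : n → ℂ) :
    ∑ i, ‖(M.mulVec x) i‖ ^ 2 ≤ ‖M‖ ^ 2 * ∑ j, ‖x j‖ ^ 2 := by
  have h := Matrix.l2_opNorm_mulVec M (WithLp.toLp 2 x)
  have h2 := pow_le_pow_left₀ (norm_nonneg _) h 2
  rw [mul_pow, EuclideanSpace.norm_sq_eq, EuclideanSpace.norm_sq_eq] at h2
  exact h2

theorem l2_opNorm_le_iff (M : Matrix m n ℂ) {c : ℝ} (hc : 0 ≤ c) :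
    ‖M‖ ≤ c ↔ ∀ x : n → ℂ, ∑ i, ‖(M.mulVec x) i‖ ^ 2 ≤ c ^ 2 * ∑ j, ‖x j‖ ^ 2 := by
  constructor
  · intro h x
    exact (sum_norm_sq_mulVec_le M x).trans (by gcongr)
  · intro h
    rw [Matrix.l2_opNorm_def]
    refine ContinuousLinearMap.opNorm_le_bound _ hc fun x => ?_
    rw [← sq_le_sq₀ (norm_nonneg _) (by positivity), mul_pow, EuclideanSpace.norm_sq_eq,
      EuclideanSpace.norm_sq_eq]
    exact h x

theorem l2_opNorm_submatrix_equiv (M : Matrix m n ℂ) (e : m' ≃ m) (f : n' ≃ n) :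
    ‖M.submatrix e f‖ = ‖M‖ := by
  have key : ∀ c : ℝ, 0 ≤ c → (‖M.submatrix e f‖ ≤ c ↔ ‖M‖ ≤ c) := by
    intro c hc
    rw [l2_opNorm_le_iff _ hc, l2_opNorm_le_iff _ hc]
    have h1 : ∀ x : n' → ℂ, ∑ i, ‖((M.submatrix e f).mulVec x) i‖ ^ 2
        = ∑ i, ‖(M.mulVec (x ∘ f.symm)) i‖ ^ 2 := by
      intro x
      rw [Matrix.submatrix_mulVec_equiv, ← e.sum_comp]
      rfl
    have h2 : ∀ x : n' → ℂ, ∑ j, ‖x j‖ ^ 2 = ∑ j, ‖(x ∘ f.symm) j‖ ^ 2 := by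
      intro x
      rw [← f.symm.sum_comp]
      rfl
    constructor
    · intro h x
      have := h (x ∘ f)
      rw [h1, h2] at this
      simpa [Function.comp_assoc] using this
    · intro h x
      rw [h1, h2]
      exact h _
  exact le_antisymm ((key _ (norm_nonneg _)).2 le_rfl) ((key _ (norm_nonneg _)).1 le_rfl)

/-- Only the Gram matrix `M* M` enters, so a matrix inequality between Gram matrices passes from
scalar vectors to tuples in any inner product space. -/
theorem inner_sum_smul_sum_smul {X : Type*} [NormedAddCommGroup X] [InnerProductSpace ℂ X]
    (M : Matrix m n ℂ) (x : n → X) :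
    (((∑ i, ‖∑ j, M i j • x j‖ ^ 2 : ℝ)) : ℂ)
      = ∑ j, ∑ l, (M.conjTranspose * M) j l * inner ℂ (x j) (x l) := by
  push_cast
  have h : ∀ i, ((‖∑ j, M i j • x j‖ : ℂ)) ^ 2
      = ∑ j, ∑ l, star (M i j) * M i l * inner ℂ (x j) (x l) := by
    intro i
    have := (inner_self_eq_norm_sq_to_K (𝕜 := ℂ) (∑ j, M i j • x j)).symm
    refine this.trans ?_
    rw [sum_inner]
    refine Finset.sum_congr rfl fun j _ => ?_
    rw [inner_sum]
    refine Finset.sum_congr rfl fun l _ => ?_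
    rw [inner_smul_left, inner_smul_right, mul_assoc]
    rfl
  simp only [h, Matrix.mul_apply, Matrix.conjTranspose_apply, Finset.sum_mul]
  rw [Finset.sum_comm]
  exact Finset.sum_congr rfl fun j _ => Finset.sum_comm

theorem posSemidef_of_norm_le (M : Matrix m n ℂ) {c : ℝ} (h : ‖M‖ ≤ c) :
    (((c : ℂ) ^ 2) • (1 : Matrix n n ℂ) - M.conjTranspose * M).PosSemidef := by
  have hc : 0 ≤ c := (norm_nonneg _).trans h
  refine Matrix.PosSemidef.of_dotProduct_mulVec_nonneg ?_ fun x => ?_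
  · refine Matrix.IsHermitian.sub ?_ (Matrix.isHermitian_conjTranspose_mul_self M)
    simp [Matrix.IsHermitian, Matrix.conjTranspose_smul]
  · have h1 := (l2_opNorm_le_iff M hc).1 h x
    have e1 : star x ⬝ᵥ x = ((∑ j, ‖x j‖ ^ 2 : ℝ) : ℂ) := by
      simp [dotProduct, Complex.conj_mul']
    have e2 : star x ⬝ᵥ (M.conjTranspose * M).mulVec x
        = ((∑ i, ‖(M.mulVec x) i‖ ^ 2 : ℝ) : ℂ) := by
      rw [← Matrix.mulVec_mulVec, Matrix.dotProduct_mulVec, Matrix.vecMul_conjTranspose, star_star]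
      simp [dotProduct, Complex.conj_mul']
    rw [Matrix.sub_mulVec, dotProduct_sub, Matrix.smul_mulVec, Matrix.one_mulVec,
      dotProduct_smul, e1, e2, smul_eq_mul]
    have : ((0 : ℝ) : ℂ) ≤ ((c ^ 2 * ∑ j, ‖x j‖ ^ 2 - ∑ i, ‖(M.mulVec x) i‖ ^ 2 : ℝ) : ℂ) :=
      Complex.real_le_real.2 (sub_nonneg.2 h1)
    simpa using this

theorem norm_le_one_iff_posSemidef (M : Matrix m n ℂ) :
    ‖M‖ ≤ 1 ↔ (1 - M.conjTranspose * M).PosSemidef := by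
  constructor
  · intro h
    simpa using posSemidef_of_norm_le M h
  · intro h
    rw [l2_opNorm_le_iff _ zero_le_one]
    intro x
    have h1 := h.dotProduct_mulVec_nonneg x
    have e1 : star x ⬝ᵥ x = ((∑ j, ‖x j‖ ^ 2 : ℝ) : ℂ) := by
      simp [dotProduct, Complex.conj_mul']
    have e2 : star x ⬝ᵥ (M.conjTranspose * M).mulVec x
        = ((∑ i, ‖(M.mulVec x) i‖ ^ 2 : ℝ) : ℂ) := by
      rw [← Matrix.mulVec_mulVec, Matrix.dotProduct_mulVec, Matrix.vecMul_conjTranspose, star_star]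
      simp [dotProduct, Complex.conj_mul']
    rw [Matrix.sub_mulVec, dotProduct_sub, Matrix.one_mulVec, e1, e2, ← Complex.ofReal_sub] at h1
    have := Complex.zero_le_real.1 h1
    linarith

/-- Applying a scalar matrix to a tuple of vectors of an inner product space. -/
theorem sum_norm_sq_sum_smul_le {X : Type*} [NormedAddCommGroup X] [InnerProductSpace ℂ X]
    (M : Matrix m n ℂ) {c : ℝ} (h : ‖M‖ ≤ c) (x : n → X) :
    ∑ i, ‖∑ j, M i j • x j‖ ^ 2 ≤ c ^ 2 * ∑ j, ‖x j‖ ^ 2 := by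
  -- Factoring `c² - M* M = R* R` turns the difference of the two sides into a sum of squared norms.
  obtain ⟨R, hR⟩ : ∃ R : Matrix n n ℂ,
      ((c : ℂ) ^ 2) • (1 : Matrix n n ℂ) - M.conjTranspose * M = R.conjTranspose * R := by
    open scoped MatrixOrder in
    have h0 : 0 ≤ ((c : ℂ) ^ 2) • (1 : Matrix n n ℂ) - M.conjTranspose * M :=
      Matrix.nonneg_iff_posSemidef.2 (posSemidef_of_norm_le M h)
    obtain ⟨R, hR⟩ := CStarAlgebra.nonneg_iff_eq_star_mul_self.1 h0
    exact ⟨R, hR⟩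
  have h1 := inner_sum_smul_sum_smul M x
  have h2 := inner_sum_smul_sum_smul R x
  rw [← hR] at h2
  have h3 : ((∑ i, ‖∑ j, R i j • x j‖ ^ 2 : ℝ) : ℂ)
      = ((c ^ 2 * ∑ j, ‖x j‖ ^ 2 - ∑ i, ‖∑ j, M i j • x j‖ ^ 2 : ℝ) : ℂ) := by
    rw [h2, Complex.ofReal_sub, h1]
    simp only [Matrix.sub_apply, sub_mul, Finset.sum_sub_distrib, Matrix.smul_apply,
      Matrix.one_apply, smul_eq_mul, mul_ite, mul_one, mul_zero, ite_mul, zero_mul,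
      Finset.sum_ite_eq, Finset.mem_univ, if_true, Finset.mul_sum]
    push_cast
    simp [inner_self_eq_norm_sq_to_K]
  have h4 := Complex.ofReal_injective h3
  have : 0 ≤ ∑ i, ‖∑ j, R i j • x j‖ ^ 2 := by positivity
  linarith

end MatrixNorm

end BallHom

namespace BallHom

/-! ### Schur complements and triangular block contractions -/

section Schur

open scoped ComplexOrder

variable {m n : Type*} [Fintype m] [Fintype n] [DecidableEq m] [DecidableEq n]

/-- A Schur complement criterion for an upper triangular block matrix to be a contraction. -/
theorem norm_fromBlocks_le_one_iff {B₁ S : Matrix m m ℂ} {B₂ R : Matrix n n ℂ}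
    (C : Matrix m n ℂ) (hP : (1 - B₁.conjTranspose * B₁).PosDef)
    (hS : S.conjTranspose * S = 1 + B₁ * (1 - B₁.conjTranspose * B₁)⁻¹ * B₁.conjTranspose)
    (hR : R.conjTranspose * (1 - B₂.conjTranspose * B₂) * R = 1) (hRu : IsUnit R) :
    ‖Matrix.fromBlocks B₁ C 0 B₂‖ ≤ 1 ↔ ‖S * C * R‖ ≤ 1 := by
  set P := 1 - B₁.conjTranspose * B₁ with hPdef
  have : Invertible P := hP.isUnit.invertible
  rw [norm_le_one_iff_posSemidef, norm_le_one_iff_posSemidef]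
  have h1 : 1 - (Matrix.fromBlocks B₁ C 0 B₂).conjTranspose * Matrix.fromBlocks B₁ C 0 B₂
      = Matrix.fromBlocks P (-(B₁.conjTranspose * C)) (-(B₁.conjTranspose * C)).conjTranspose
        (1 - B₂.conjTranspose * B₂ - C.conjTranspose * C) := by
    rw [Matrix.fromBlocks_conjTranspose, Matrix.fromBlocks_multiply, ← Matrix.fromBlocks_one,
      sub_eq_add_neg, Matrix.fromBlocks_neg, Matrix.fromBlocks_add]
    congr 1 <;> simp [hPdef, Matrix.conjTranspose_mul, sub_eq_add_neg]
    abel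
  -- The Schur complement of `P` is `1 - B₂* B₂ - C* (1 + B₁ P⁻¹ B₁*) C`; conjugation by the
  -- invertible `R` normalizes its first part to `1`.
  rw [h1, Matrix.PosDef.fromBlocks₁₁ _ _ hP, ← Matrix.IsUnit.posSemidef_star_left_conjugate_iff hRu]
  have h2 : star R * (1 - B₂.conjTranspose * B₂ - C.conjTranspose * C
      - (-(B₁.conjTranspose * C)).conjTranspose * P⁻¹ * -(B₁.conjTranspose * C)) * R
      = 1 - (S * C * R).conjTranspose * (S * C * R) := by
    have h3 : (S * C * R).conjTranspose * (S * C * R)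
        = R.conjTranspose * (C.conjTranspose * (S.conjTranspose * S) * C) * R := by
      simp only [Matrix.conjTranspose_mul, Matrix.mul_assoc]
    rw [h3, hS, Matrix.star_eq_conjTranspose]
    conv_rhs => rw [← hR, ← Matrix.sub_mul, ← Matrix.mul_sub]
    congr 2
    simp only [Matrix.conjTranspose_neg, Matrix.conjTranspose_mul,
      Matrix.conjTranspose_conjTranspose, Matrix.neg_mul, Matrix.mul_neg, neg_neg, Matrix.mul_add,
      Matrix.add_mul, Matrix.mul_one, Matrix.mul_assoc]
    abel
  rw [h2]

theorem exists_conjTranspose_mul_self {P : Matrix n n ℂ} (h : P.PosSemidef) :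
    ∃ Q : Matrix n n ℂ, P = Q.conjTranspose * Q := by
  open scoped MatrixOrder in
  exact CStarAlgebra.nonneg_iff_eq_star_mul_self.1 (Matrix.nonneg_iff_posSemidef.2 h)

theorem posDef_one_sub_of_norm_lt_one {B : Matrix n n ℂ} (hB : ‖B‖ < 1) :
    (1 - B.conjTranspose * B).PosDef := by
  have h1 := (norm_le_one_iff_posSemidef B).1 hB.le
  rw [h1.posDef_iff_isUnit]
  refine isUnit_one_sub_of_norm_lt_one ?_
  rw [Matrix.l2_opNorm_conjTranspose_mul_self]
  exact mul_lt_one_of_nonneg_of_lt_one_left (norm_nonneg _) hB hB.le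

/-- For a strict contraction `B`, contractivity of the triangular block matrices with both
diagonal blocks `B`, and of their amplifications, is governed by one pair of matrices. -/
theorem exists_norm_fromBlocks_kronecker_iff {B : Matrix n n ℂ} (hB : ‖B‖ < 1) :
    ∃ S R : Matrix n n ℂ,
      (∀ C : Matrix n n ℂ, ‖Matrix.fromBlocks B C 0 B‖ ≤ 1 ↔ ‖S * C * R‖ ≤ 1) ∧
      ∀ (p q : ℕ) (C : Matrix (n × Fin p) (n × Fin q) ℂ),
        ‖Matrix.fromBlocks (B ⊗ₖ (1 : Matrix (Fin p) (Fin p) ℂ)) C 0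
            (B ⊗ₖ (1 : Matrix (Fin q) (Fin q) ℂ))‖ ≤ 1 ↔
          ‖(S ⊗ₖ (1 : Matrix (Fin p) (Fin p) ℂ)) * C
            * (R ⊗ₖ (1 : Matrix (Fin q) (Fin q) ℂ))‖ ≤ 1 := by
  have hP := posDef_one_sub_of_norm_lt_one hB
  -- With `Q* Q = P = 1 - B* B` and `S* S = 1 + B P⁻¹ B*`, the pair is `S` and `R = Q⁻¹`. Strictness
  -- of `‖B‖ < 1` makes `Q` invertible, and all these identities survive tensoring with an identity
  -- matrix.
  obtain ⟨Q, hQ⟩ := exists_conjTranspose_mul_self hP.posSemidef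
  obtain ⟨S, hS⟩ := exists_conjTranspose_mul_self
    (Matrix.PosSemidef.one.add (hP.inv.posSemidef.mul_mul_conjTranspose_same B))
  have hQu : IsUnit Q := by
    have h := hP.isUnit
    rw [hQ, Matrix.isUnit_iff_isUnit_det, Matrix.det_mul] at h
    rw [Matrix.isUnit_iff_isUnit_det]
    exact isUnit_of_mul_isUnit_right h
  have hQd : IsUnit Q.det := (Matrix.isUnit_iff_isUnit_det _).1 hQu
  have hRu : IsUnit Q⁻¹ := by
    rw [Matrix.isUnit_iff_isUnit_det]
    exact Matrix.isUnit_nonsing_inv_det _ hQd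
  have hR : (Q⁻¹).conjTranspose * (1 - B.conjTranspose * B) * Q⁻¹ = 1 := by
    rw [hQ, ← Matrix.mul_assoc, ← Matrix.conjTranspose_mul, Matrix.mul_nonsing_inv _ hQd,
      Matrix.conjTranspose_one, Matrix.one_mul, Matrix.mul_nonsing_inv _ hQd]
  have hk : ∀ p : ℕ, (1 : Matrix (n × Fin p) (n × Fin p) ℂ)
      - (B ⊗ₖ (1 : Matrix (Fin p) (Fin p) ℂ)).conjTranspose * (B ⊗ₖ (1 : Matrix (Fin p) (Fin p) ℂ))
      = (1 - B.conjTranspose * B) ⊗ₖ (1 : Matrix (Fin p) (Fin p) ℂ) := by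
    intro p
    rw [Matrix.conjTranspose_kronecker, ← Matrix.mul_kronecker_mul, Matrix.conjTranspose_one,
      Matrix.one_mul, sub_eq_iff_eq_add, ← Matrix.add_kronecker, sub_add_cancel,
      Matrix.one_kronecker_one]
  refine ⟨S, Q⁻¹, fun C => norm_fromBlocks_le_one_iff C hP hS.symm hR hRu, fun p q C => ?_⟩
  refine norm_fromBlocks_le_one_iff C ?_ ?_ ?_ ?_
  · rw [hk]
    exact hP.kronecker Matrix.PosDef.one
  · rw [hk, Matrix.inv_kronecker, Matrix.conjTranspose_kronecker, Matrix.conjTranspose_kronecker,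
      ← Matrix.mul_kronecker_mul, ← Matrix.mul_kronecker_mul, ← Matrix.mul_kronecker_mul, ← hS,
      Matrix.add_kronecker]
    simp
  · rw [hk, Matrix.conjTranspose_kronecker, ← Matrix.mul_kronecker_mul, ← Matrix.mul_kronecker_mul,
      hR]
    simp
  · rw [Matrix.isUnit_iff_isUnit_det, Matrix.det_kronecker]
    simpa using ((Matrix.isUnit_iff_isUnit_det _).1 hRu).pow _

end Schur

end BallHom

namespace BallHom

/-! ### Parseval on the circle and a matrix-valued Schwarz lemma -/

section Schwarz

open Real Metric

variable {U : Set ℂ}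

/-- In the expansion of `‖g‖²` around `g 0` the cross term is the real part of a holomorphic
function vanishing at `0`, so its mean is zero. -/
theorem circleAverage_norm_sq (hUs : closedBall (0 : ℂ) 1 ⊆ U)
    {g : ℂ → ℂ} (hg : DifferentiableOn ℂ g U) :
    circleAverage (fun ζ => ‖g ζ‖ ^ 2) 0 1
      = ‖g 0‖ ^ 2 + circleAverage (fun ζ => ‖g ζ - g 0‖ ^ 2) 0 1 := by
  have hS : sphere (0 : ℂ) |1| ⊆ U := by
    rw [abs_one]
    exact sphere_subset_closedBall.trans hUs
  have hc := hg.continuousOn.mono hS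
  set G : ℂ → ℂ := fun ζ => (2 * star (g 0)) * (g ζ - g 0) with hG
  have hGd : DifferentiableOn ℂ G U := (hg.sub_const _).const_mul _
  have hGm : circleAverage G 0 1 = 0 := by
    rw [DiffContOnCl.circleAverage]
    · simp [hG]
    · rw [abs_one]
      exact hGd.diffContOnCl_ball hUs
  have hGi : CircleIntegrable G 0 1 := (hGd.continuousOn.mono hS).circleIntegrable'
  have hre : circleAverage (fun ζ => (G ζ).re) 0 1 = 0 := by
    have := Complex.reCLM.circleAverage_comp_comm hGi
    rw [hGm, map_zero] at this
    exact this
  have h1 : (fun ζ => ‖g ζ‖ ^ 2)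
      = fun ζ => (‖g 0‖ ^ 2 + ‖g ζ - g 0‖ ^ 2) + (G ζ).re := by
    funext ζ
    simp only [hG, Complex.sq_norm, Complex.normSq_apply]
    simp
    ring
  have hi : CircleIntegrable (fun ζ => ‖g ζ - g 0‖ ^ 2) 0 1 :=
    ContinuousOn.circleIntegrable' ((hc.sub continuousOn_const).norm.pow 2)
  have hi0 : CircleIntegrable (fun _ : ℂ => ‖g 0‖ ^ 2) 0 1 :=
    ContinuousOn.circleIntegrable' continuousOn_const
  have hir : CircleIntegrable (fun ζ => (G ζ).re) 0 1 :=
    ContinuousOn.circleIntegrable' (Complex.continuous_re.comp_continuousOn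
      (hGd.continuousOn.mono hS))
  have hi1 : CircleIntegrable (fun ζ => ‖g 0‖ ^ 2 + ‖g ζ - g 0‖ ^ 2) 0 1 := hi0.add hi
  rw [h1, circleAverage_fun_add hi1 hir, hre, add_zero, circleAverage_fun_add hi0 hi,
    circleAverage_const]

/-- These are the first two terms of Parseval's identity. On the circle `g - g 0` and the difference
quotient `dslope g 0` have the same modulus, so the mean value identity applies a second time, and
`dslope g 0` takes the value `g'(0)` at `0`. -/
theorem norm_sq_add_norm_deriv_sq_le (hU : IsOpen U) (hUs : closedBall (0 : ℂ) 1 ⊆ U)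
    {g : ℂ → ℂ} (hg : DifferentiableOn ℂ g U) :
    ‖g 0‖ ^ 2 + ‖deriv g 0‖ ^ 2 ≤ circleAverage (fun ζ => ‖g ζ‖ ^ 2) 0 1 := by
  have hU0 : U ∈ nhds (0 : ℂ) := hU.mem_nhds (hUs (by simp))
  have hd : DifferentiableOn ℂ (dslope g 0) U := (Complex.differentiableOn_dslope hU0).2 hg
  rw [circleAverage_norm_sq hUs hg]
  have h1 : circleAverage (fun ζ => ‖g ζ - g 0‖ ^ 2) 0 1
      = circleAverage (fun ζ => ‖dslope g 0 ζ‖ ^ 2) 0 1 := by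
    refine circleAverage_congr_sphere fun ζ hζ => ?_
    have hn : ‖ζ‖ = 1 := by simpa using hζ
    have : g ζ - g 0 = ζ * dslope g 0 ζ := by
      have := sub_smul_dslope g 0 ζ
      simpa using this.symm
    simp [this, hn]
  rw [h1, circleAverage_norm_sq hUs hd, dslope_same]
  have : 0 ≤ circleAverage (fun ζ => ‖dslope g 0 ζ - deriv g 0‖ ^ 2) 0 1 :=
    circleAverage_nonneg_of_nonneg fun _ _ => by positivity
  linarith

theorem circleAverage_norm_add_mul_sq (a b : ℂ) :
    circleAverage (fun ζ => ‖a + ζ * b‖ ^ 2) 0 1 = ‖a‖ ^ 2 + ‖b‖ ^ 2 := by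
  rw [circleAverage_norm_sq (U := Set.univ) (Set.subset_univ _)
    (g := fun ζ => a + ζ * b) (by fun_prop)]
  congr 1
  · simp
  · refine circleAverage_const_on_circle fun ζ hζ => ?_
    have hn : ‖ζ‖ = 1 := by simpa using hζ
    simp [hn]

/-- A matrix-valued Schwarz lemma: value and derivative at the centre of a contractive
holomorphic matrix function form a contractive block Toeplitz matrix. -/
theorem norm_fromBlocks_deriv_le_one {n : Type*} [Fintype n] [DecidableEq n]
    (hU : IsOpen U) (hUs : closedBall (0 : ℂ) 1 ⊆ U) {F : ℂ → Matrix n n ℂ}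
    (hF : ∀ i j, DifferentiableOn ℂ (fun ζ => F ζ i j) U)
    (hb : ∀ ζ ∈ sphere (0 : ℂ) 1, ‖F ζ‖ ≤ 1) :
    ‖Matrix.fromBlocks (F 0) (Matrix.of fun i j => deriv (fun ζ => F ζ i j) 0) 0 (F 0)‖ ≤ 1 := by
  rw [l2_opNorm_le_iff _ zero_le_one]
  intro x
  have h0 : (0 : ℂ) ∈ U := hUs (by simp)
  have hS : sphere (0 : ℂ) |1| ⊆ U := by
    rw [abs_one]
    exact sphere_subset_closedBall.trans hUs
  -- `g(ζ) = F(ζ)(x_r + ζ x_l)`: its derivative and value at `0` are the two components of the block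
  -- matrix applied to `x = (x_l, x_r)`, and on the circle `‖g(ζ)‖ ≤ ‖x_r + ζ x_l‖`.
  set g : n → ℂ → ℂ := fun i ζ =>
    ∑ j, F ζ i j * (x (Sum.inr j) + ζ * x (Sum.inl j)) with hg
  have hgd : ∀ i, DifferentiableOn ℂ (g i) U := fun i =>
    DifferentiableOn.fun_sum fun j _ => (hF i j).mul (by fun_prop)
  have hg0 : ∀ i, g i 0 = ∑ j, F 0 i j * x (Sum.inr j) := by simp [hg]
  have hg1 : ∀ i, deriv (g i) 0 = ∑ j, (deriv (fun ζ => F ζ i j) 0 * x (Sum.inr j)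
      + F 0 i j * x (Sum.inl j)) := by
    intro i
    have hd : ∀ j, HasDerivAt (fun ζ => F ζ i j * (x (Sum.inr j) + ζ * x (Sum.inl j)))
        (deriv (fun ζ => F ζ i j) 0 * x (Sum.inr j) + F 0 i j * x (Sum.inl j)) 0 := by
      intro j
      have h1 := ((hF i j).differentiableAt (hU.mem_nhds h0)).hasDerivAt
      have h2 : HasDerivAt (fun ζ : ℂ => x (Sum.inr j) + ζ * x (Sum.inl j)) (x (Sum.inl j)) 0 := by
        simpa using ((hasDerivAt_id (0 : ℂ)).mul_const (x (Sum.inl j))).const_add (x (Sum.inr j))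
      simpa using! h1.mul h2
    exact (HasDerivAt.fun_sum fun j _ => hd j).deriv
  have hi : ∀ i, CircleIntegrable (fun ζ => ‖g i ζ‖ ^ 2) 0 1 := fun i =>
    ContinuousOn.circleIntegrable' (((hgd i).continuousOn.mono hS).norm.pow 2)
  have hi' : ∀ j : n,
      CircleIntegrable (fun ζ => ‖x (Sum.inr j) + ζ * x (Sum.inl j)‖ ^ 2) 0 1 := fun j =>
    ContinuousOn.circleIntegrable' (by fun_prop)
  rw [Fintype.sum_sum_type, Fintype.sum_sum_type, one_pow, one_mul]
  have e1 : ∀ i, ((Matrix.fromBlocks (F 0) (Matrix.of fun i j => deriv (fun ζ => F ζ i j) 0) 0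
      (F 0)).mulVec x) (Sum.inl i) = deriv (g i) 0 := by
    intro i
    rw [hg1, Matrix.mulVec, dotProduct, Fintype.sum_sum_type, Finset.sum_add_distrib, add_comm]
    rfl
  have e2 : ∀ i, ((Matrix.fromBlocks (F 0) (Matrix.of fun i j => deriv (fun ζ => F ζ i j) 0) 0
      (F 0)).mulVec x) (Sum.inr i) = g i 0 := by
    intro i
    rw [hg0, Matrix.mulVec, dotProduct, Fintype.sum_sum_type]
    simp
  simp only [e1, e2]
  calc ∑ i, ‖deriv (g i) 0‖ ^ 2 + ∑ i, ‖g i 0‖ ^ 2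
      = ∑ i, (‖g i 0‖ ^ 2 + ‖deriv (g i) 0‖ ^ 2) := by rw [Finset.sum_add_distrib, add_comm]
    _ ≤ ∑ i, circleAverage (fun ζ => ‖g i ζ‖ ^ 2) 0 1 :=
        Finset.sum_le_sum fun i _ => norm_sq_add_norm_deriv_sq_le hU hUs (hgd i)
    _ = circleAverage (fun ζ => ∑ i, ‖g i ζ‖ ^ 2) 0 1 :=
        (circleAverage_fun_sum fun i _ => hi i).symm
    _ ≤ circleAverage (fun ζ => ∑ j, ‖x (Sum.inr j) + ζ * x (Sum.inl j)‖ ^ 2) 0 1 := by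
        refine circleAverage_mono (CircleIntegrable.fun_sum _ fun i _ => hi i)
          (CircleIntegrable.fun_sum _ fun i _ => hi' i) fun ζ hζ => ?_
        rw [abs_one] at hζ
        have := (l2_opNorm_le_iff _ zero_le_one).1 (hb ζ hζ)
          fun j => x (Sum.inr j) + ζ * x (Sum.inl j)
        rw [one_pow, one_mul] at this
        exact this
    _ = ∑ j, circleAverage (fun ζ => ‖x (Sum.inr j) + ζ * x (Sum.inl j)‖ ^ 2) 0 1 :=
        circleAverage_fun_sum fun i _ => hi' i
    _ = ∑ j, ‖x (Sum.inl j)‖ ^ 2 + ∑ j, ‖x (Sum.inr j)‖ ^ 2 := by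
        simp only [circleAverage_norm_add_mul_sq]
        rw [Finset.sum_add_distrib, add_comm]

end Schwarz

end BallHom

/-! ### Contractivity of `rho` and of `linMap` agree at each matrix level -/

namespace BallHom

theorem enorm_le_one_iff {E : Type*} [SeminormedAddCommGroup E] {x : E} : ‖x‖ₑ ≤ 1 ↔ ‖x‖ ≤ 1 := by
  rw [← ofReal_norm, ENNReal.ofReal_le_one]

theorem norm_blockOp_le_iff {H : Type*} [NormedAddCommGroup H] [InnerProductSpace ℂ H] {k : ℕ}
    (T : Matrix (Fin k) (Fin k) (H →L[ℂ] H)) {c : ℝ} (hc : 0 ≤ c) :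
    ‖blockOp T‖ ≤ c ↔ ∀ x : Fin k → H,
      ∑ i, ‖∑ j, T i j (x j)‖ ^ 2 ≤ c ^ 2 * ∑ j, ‖x j‖ ^ 2 := by
  have key : ∀ x : PiLp 2 (fun _ : Fin k => H),
      ‖blockOp T x‖ ≤ c * ‖x‖ ↔ ∑ i, ‖∑ j, T i j (x j)‖ ^ 2 ≤ c ^ 2 * ∑ j, ‖x j‖ ^ 2 := by
    intro x
    rw [← sq_le_sq₀ (norm_nonneg _) (by positivity), mul_pow, PiLp.norm_sq_eq_of_L2,
      PiLp.norm_sq_eq_of_L2]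
    simp only [blockOp_apply]
  rw [ContinuousLinearMap.opNorm_le_iff hc]
  exact ⟨fun h x => (key (WithLp.toLp 2 x)).1 (h _), fun h x => (key x).2 (h x)⟩

theorem norm_blockOp_toEuclideanCLM {n : Type*} [Fintype n] [DecidableEq n] {k : ℕ}
    (N : Matrix (Fin k) (Fin k) (Matrix n n ℂ)) :
    ‖blockOp (N.map fun X => Matrix.toEuclideanCLM (n := n) (𝕜 := ℂ) X)‖
      = ‖(Matrix.of fun a b : Fin k × n => N a.1 b.1 a.2 b.2)‖ := by
  have key : ∀ c : ℝ, 0 ≤ c →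
      (‖blockOp (N.map fun X => Matrix.toEuclideanCLM (n := n) (𝕜 := ℂ) X)‖ ≤ c ↔
        ‖(Matrix.of fun a b : Fin k × n => N a.1 b.1 a.2 b.2)‖ ≤ c) := by
    intro c hc
    rw [norm_blockOp_le_iff _ hc, l2_opNorm_le_iff _ hc]
    have h1 : ∀ x : Fin k → EuclideanSpace ℂ n,
        ∑ i, ‖∑ j, (N.map fun X => Matrix.toEuclideanCLM (n := n) (𝕜 := ℂ) X) i j (x j)‖ ^ 2
        = ∑ a, ‖((Matrix.of fun a b : Fin k × n => N a.1 b.1 a.2 b.2).mulVec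
            fun b => x b.1 b.2) a‖ ^ 2 := by
      intro x
      rw [Fintype.sum_prod_type]
      refine Finset.sum_congr rfl fun i _ => ?_
      rw [EuclideanSpace.norm_sq_eq]
      refine Finset.sum_congr rfl fun a _ => ?_
      congr 2
      rw [Matrix.mulVec, dotProduct, Fintype.sum_prod_type]
      simp [Matrix.mulVec, dotProduct, Matrix.ofLp_toEuclideanCLM]
    have h2 : ∀ x : Fin k → EuclideanSpace ℂ n,
        ∑ j, ‖x j‖ ^ 2 = ∑ b : Fin k × n, ‖x b.1 b.2‖ ^ 2 := by
      intro x
      rw [Fintype.sum_prod_type]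
      exact Finset.sum_congr rfl fun i _ => EuclideanSpace.norm_sq_eq _
    constructor
    · intro h x
      have := h fun i => WithLp.toLp 2 fun a => x (i, a)
      rw [h1, h2] at this
      exact this
    · intro h x
      rw [h1, h2]
      exact h _
  exact le_antisymm ((key _ (norm_nonneg _)).2 le_rfl) ((key _ (norm_nonneg _)).1 le_rfl)

variable {A : Fin 2 → Matrix (Fin 2) (Fin 2) ℂ}

/-- Evaluation of a matrix of functions. -/
def evalAt {k : ℕ} (F : Matrix (Fin k) (Fin k) (holo A)) (z : Fin 2 → ℂ) :
    Matrix (Fin k) (Fin k) ℂ :=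
  F.map fun f => (f : (Fin 2 → ℂ) → ℂ) z

/-- The partial derivatives at the origin of a matrix of functions. -/
noncomputable def partialAt {k : ℕ} (F : Matrix (Fin k) (Fin k) (holo A)) (l : Fin 2) :
    Matrix (Fin k) (Fin k) ℂ :=
  F.map fun f => partialZero (f : (Fin 2 → ℂ) → ℂ) l

theorem norm_blockOp_rho {p q k : ℕ} (V : Fin 2 → Matrix (Fin p) (Fin q) ℂ)
    (F : Matrix (Fin k) (Fin k) (holo A)) :
    ‖blockOp (F.map (rho A V))‖
      = ‖Matrix.fromBlocks (evalAt F 0 ⊗ₖ (1 : Matrix (Fin p) (Fin p) ℂ))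
          (linMapAt V (partialAt F)) 0 (evalAt F 0 ⊗ₖ (1 : Matrix (Fin q) (Fin q) ℂ))‖ := by
  have h := norm_blockOp_toEuclideanCLM
    (F.map fun f => rhoMatrix V (f : (Fin 2 → ℂ) → ℂ))
  refine h.trans ?_
  -- Regrouping `k × (p ⊕ q)` as `(k × p) ⊕ (k × q)` makes the amplification a single triangular
  -- block matrix.
  rw [← l2_opNorm_submatrix_equiv _ (Equiv.prodSumDistrib (Fin k) (Fin p) (Fin q)).symm
    (Equiv.prodSumDistrib (Fin k) (Fin p) (Fin q)).symm]
  congr 1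
  ext a b
  rcases a with ⟨i, a⟩ | ⟨i, a⟩ <;> rcases b with ⟨j, b⟩ | ⟨j, b⟩ <;>
    simp [rhoMatrix, evalAt, partialAt, linMapAt, Matrix.kroneckerMap_apply]

theorem norm_le_norm_fromBlocks {m n m' n' : Type*} [Fintype m] [Fintype n] [Fintype m']
    [Fintype n'] [DecidableEq m] [DecidableEq n] [DecidableEq m'] [DecidableEq n']
    (X : Matrix m n ℂ) (C : Matrix m n' ℂ) (Y : Matrix m' n ℂ) (Z : Matrix m' n' ℂ) :
    ‖C‖ ≤ ‖Matrix.fromBlocks X C Y Z‖ := by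
  rw [l2_opNorm_le_iff _ (norm_nonneg _)]
  intro x
  have h := sum_norm_sq_mulVec_le (Matrix.fromBlocks X C Y Z) (Sum.elim 0 x)
  rw [Matrix.fromBlocks_mulVec, Fintype.sum_sum_type, Fintype.sum_sum_type] at h
  simp only [Sum.elim_inl, Sum.elim_inr, Pi.zero_apply, norm_zero, Sum.elim_comp_inl,
    Sum.elim_comp_inr, Matrix.mulVec_zero, zero_add, ne_eq, OfNat.ofNat_ne_zero,
    not_false_eq_true, zero_pow, Finset.sum_const_zero] at h
  have : 0 ≤ ∑ i, ‖(Z.mulVec x) i‖ ^ 2 := by positivity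
  linarith

theorem zero_mem_unitBall : (0 : Fin 2 → ℂ) ∈ unitBall A := by
  simp [unitBall, normA]

theorem normA_smul (c : ℂ) (z : Fin 2 → ℂ) : normA A (c • z) = ‖c‖ * normA A z := by
  simp only [normA, Pi.smul_apply, smul_assoc, ← Finset.smul_sum, norm_smul]

theorem smul_mem_unitBall {z : Fin 2 → ℂ} (hz : z ∈ unitBall A) {c : ℂ} (hc : ‖c‖ ≤ 1) :
    c • z ∈ unitBall A := by
  have : normA A z < 1 := hz
  change normA A (c • z) < 1
  rw [normA_smul]
  exact (mul_le_of_le_one_left (norm_nonneg _) hc).trans_lt this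

theorem unitBall_subset_closedUnitBall : unitBall A ⊆ closedUnitBall A := fun _ hz =>
  le_of_lt (show normA A _ < 1 from hz)

theorem exists_isOpen_differentiableOn {k : ℕ} (F : Matrix (Fin k) (Fin k) (holo A)) :
    ∃ U : Set (Fin 2 → ℂ), IsOpen U ∧ closedUnitBall A ⊆ U ∧
      ∀ i j, DifferentiableOn ℂ (F i j : (Fin 2 → ℂ) → ℂ) U := by
  choose U hU hAU hd using fun i j => (F i j).2
  refine ⟨⋂ i, ⋂ j, U i j, isOpen_iInter_of_finite fun i => isOpen_iInter_of_finite fun j => hU i j,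
    Set.subset_iInter fun i => Set.subset_iInter fun j => hAU i j, fun i j => (hd i j).mono ?_⟩
  exact (Set.iInter_subset _ i).trans (Set.iInter_subset _ j)

theorem fderiv_zero_apply (f : (Fin 2 → ℂ) → ℂ) (z : Fin 2 → ℂ) :
    fderiv ℂ f 0 z = ∑ l, z l * partialZero f l := by
  conv_lhs => rw [← Finset.univ_sum_single z]
  rw [map_sum]
  refine Finset.sum_congr rfl fun l _ => ?_
  have : (Pi.single l (z l) : Fin 2 → ℂ) = z l • Pi.single l 1 := by
    rw [← Pi.single_smul]
    simp
  rw [this, map_smul, smul_eq_mul, partialZero]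

/-- The Schwarz lemma on the ball, for matrices of functions. -/
theorem norm_fromBlocks_partialAt_le_one {k : ℕ} (F : Matrix (Fin k) (Fin k) (holo A))
    (hF : ∀ z ∈ unitBall A, ‖evalAt F z‖ ≤ 1) {z : Fin 2 → ℂ} (hz : z ∈ unitBall A) :
    ‖Matrix.fromBlocks (evalAt F 0) (∑ l, z l • partialAt F l) 0 (evalAt F 0)‖ ≤ 1 := by
  obtain ⟨U, hU, hAU, hd⟩ := exists_isOpen_differentiableOn F
  have hline : Differentiable ℂ fun ζ : ℂ => ζ • z := by fun_prop
  have h := norm_fromBlocks_deriv_le_one (U := (fun ζ : ℂ => ζ • z) ⁻¹' U)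
    (F := fun ζ => evalAt F (ζ • z)) (hU.preimage hline.continuous)
    (fun ζ hζ => hAU (unitBall_subset_closedUnitBall
      (smul_mem_unitBall hz (by simpa using hζ))))
    (fun i j => (hd i j).comp hline.differentiableOn fun _ h => h)
    (fun ζ hζ => hF _ (smul_mem_unitBall hz (by simpa using (Metric.mem_sphere.1 hζ).le)))
  have e : (Matrix.of fun i j => deriv (fun ζ : ℂ => evalAt F (ζ • z) i j) 0)
      = ∑ l, z l • partialAt F l := by
    ext i j
    have h1 : HasFDerivAt (F i j : (Fin 2 → ℂ) → ℂ)
        (fderiv ℂ (F i j : (Fin 2 → ℂ) → ℂ) 0) ((0 : ℂ) • z) := by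
      rw [zero_smul]
      exact (holo_differentiableAt_zero (F i j)).hasFDerivAt
    have h2 : HasDerivAt (fun ζ : ℂ => ζ • z) z 0 := by
      simpa using (hasDerivAt_id (0 : ℂ)).smul_const z
    have h3 := (h1.comp_hasDerivAt (0 : ℂ) h2).deriv
    rw [fderiv_zero_apply] at h3
    simpa [Matrix.sum_apply, partialAt, evalAt, Function.comp_def] using h3
  simpa [e] using h

theorem linMapAt_mul_mul {p q k : ℕ} (V : Fin 2 → Matrix (Fin p) (Fin q) ℂ)
    (Θ : Fin 2 → Matrix (Fin k) (Fin k) ℂ) (S R : Matrix (Fin k) (Fin k) ℂ) :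
    linMapAt V (fun l => S * Θ l * R) = (S ⊗ₖ (1 : Matrix (Fin p) (Fin p) ℂ)) * linMapAt V Θ
      * (R ⊗ₖ (1 : Matrix (Fin q) (Fin q) ℂ)) := by
  simp only [linMapAt, Matrix.mul_sum, Matrix.sum_mul, ← Matrix.mul_kronecker_mul,
    Matrix.one_mul, Matrix.mul_one]

/-- The Schwarz lemma and the Schur criterion for corners together say that `S ∂_l F(0) R` has dual
norm at most one. The amplified criterion with `S ⊗ 1`, `R ⊗ 1` carries the resulting bound back to
`ρ_V^(k)(F)`. -/
theorem norm_blockOp_rho_le_one {p q k : ℕ} {V : Fin 2 → Matrix (Fin p) (Fin q) ℂ}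
    (hV : LinContractiveAt A V k) (F : Matrix (Fin k) (Fin k) (holo A))
    (hF : ∀ z ∈ unitBall A, ‖evalAt F z‖ < 1) : ‖blockOp (F.map (rho A V))‖ ≤ 1 := by
  obtain ⟨S, R, h1, h2⟩ := exists_norm_fromBlocks_kronecker_iff (hF 0 zero_mem_unitBall)
  rw [norm_blockOp_rho, h2, ← linMapAt_mul_mul]
  have h3 : dualNormAt A (fun l => S * partialAt F l * R) ≤ 1 := by
    refine iSup₂_le fun z hz => ?_
    have h4 := (h1 _).1 (norm_fromBlocks_partialAt_le_one F (fun z hz => (hF z hz).le) hz)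
    have e : ∑ l, z l • (S * partialAt F l * R) = S * (∑ l, z l • partialAt F l) * R := by
      simp only [Matrix.mul_sum, Matrix.sum_mul, Matrix.mul_smul, Matrix.smul_mul]
    rw [e]
    exact enorm_le_one_iff.2 h4
  exact enorm_le_one_iff.1 ((hV _).trans h3)

theorem blockOp_map_smul {H : Type*} [NormedAddCommGroup H] [InnerProductSpace ℂ H] {k : ℕ}
    (ρ : holo A →ₐ[ℂ] (H →L[ℂ] H)) (F : Matrix (Fin k) (Fin k) (holo A)) (c : ℂ) :
    blockOp ((c • F).map ρ) = c • blockOp (F.map ρ) := by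
  ext x i
  simp [blockOp_apply, Finset.smul_sum]

theorem enorm_evalAt_le_supNorm {k : ℕ} (F : Matrix (Fin k) (Fin k) (holo A)) {z : Fin 2 → ℂ}
    (hz : z ∈ unitBall A) : ‖evalAt F z‖ₑ ≤ supNorm A F :=
  le_iSup₂ (f := fun z (_ : z ∈ unitBall A) => ‖evalAt F z‖ₑ) z hz

theorem homContractiveAt_of_linContractiveAt {p q k : ℕ} {V : Fin 2 → Matrix (Fin p) (Fin q) ℂ}
    (hV : LinContractiveAt A V k) : HomContractiveAt (rho A V) k := by
  intro F
  -- Dividing by an arbitrary `c` above the supremum yields the strict bound that the Schur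
  -- criterion needs at the origin.
  refine le_of_forall_gt_imp_ge_of_dense fun c hc => ?_
  rcases eq_or_ne c ⊤ with rfl | hct
  · exact le_top
  lift c to NNReal using hct
  have hc0 : (0 : ℝ) < c := NNReal.coe_pos.2 (ENNReal.coe_pos.1 (pos_of_gt hc))
  have hcC : (c : ℂ) ≠ 0 := by exact_mod_cast hc0.ne'
  have hF : ∀ z ∈ unitBall A, ‖evalAt ((c : ℂ)⁻¹ • F) z‖ < 1 := by
    intro z hz
    have h1 : ‖evalAt F z‖ₑ < c := (enorm_evalAt_le_supNorm F hz).trans_lt hc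
    have h2 : ‖evalAt F z‖ < c := by
      rw [enorm_eq_nnnorm, ENNReal.coe_lt_coe] at h1
      exact_mod_cast h1
    have e : evalAt ((c : ℂ)⁻¹ • F) z = (c : ℂ)⁻¹ • evalAt F z := by
      ext i j
      simp [evalAt]
    rw [e, norm_smul, norm_inv]
    simp only [Complex.norm_real, NNReal.norm_eq]
    rwa [inv_mul_lt_iff₀ hc0, mul_one]
  have h := norm_blockOp_rho_le_one hV _ hF
  rw [blockOp_map_smul, norm_smul, norm_inv] at h
  simp only [Complex.norm_real, NNReal.norm_eq] at h
  rw [inv_mul_le_iff₀ hc0, mul_one] at h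
  rw [enorm_eq_nnnorm, ENNReal.coe_le_coe]
  exact_mod_cast h

/-- The linear functional with coefficients `w`, as an element of `𝒪(Ω_A)`. -/
def linearFunction (A : Fin 2 → Matrix (Fin 2) (Fin 2) ℂ) (w : Fin 2 → ℂ) : holo A :=
  ⟨fun z => ∑ l, z l * w l, Set.univ, isOpen_univ, Set.subset_univ _, by fun_prop⟩

theorem partialZero_linearFunction (w : Fin 2 → ℂ) (l : Fin 2) :
    partialZero (linearFunction A w : (Fin 2 → ℂ) → ℂ) l = w l := by
  have h : (linearFunction A w : (Fin 2 → ℂ) → ℂ)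
      = (∑ l, w l • ContinuousLinearMap.proj l : (Fin 2 → ℂ) →L[ℂ] ℂ) := by
    funext z
    simp [linearFunction, mul_comm]
  rw [partialZero, h, ContinuousLinearMap.fderiv]
  fin_cases l <;> simp

/-- For the matrix of linear functions with coefficients `Θ`, the corner of `ρ_V^(k)` is
`L_V^(k)(Θ)`, and the supremum norm is the dual norm of `Θ`. -/
theorem linContractiveAt_of_homContractiveAt {p q k : ℕ} {V : Fin 2 → Matrix (Fin p) (Fin q) ℂ}
    (hV : HomContractiveAt (rho A V) k) : LinContractiveAt A V k := by
  intro Θ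
  set F : Matrix (Fin k) (Fin k) (holo A) :=
    Matrix.of fun i j => linearFunction A fun l => Θ l i j with hF
  have h1 : partialAt F = Θ := by
    funext l
    ext i j
    simp [hF, partialAt, partialZero_linearFunction]
  have h2 : supNorm A F = dualNormAt A Θ := by
    refine iSup_congr fun z => iSup_congr fun _ => ?_
    congr 1
  rw [← h2, ← h1]
  refine le_trans ?_ (hV F)
  rw [← ofReal_norm, ← ofReal_norm, norm_blockOp_rho]
  exact ENNReal.ofReal_le_ofReal (norm_le_norm_fromBlocks _ _ _ _)

theorem homContractiveAt_rho_iff {p q k : ℕ} (V : Fin 2 → Matrix (Fin p) (Fin q) ℂ) :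
    HomContractiveAt (rho A V) k ↔ LinContractiveAt A V k :=
  ⟨linContractiveAt_of_homContractiveAt, homContractiveAt_of_linContractiveAt⟩

theorem norm_matrix_fin_one (M : Matrix (Fin 1) (Fin 1) ℂ) : ‖M‖ = ‖M 0 0‖ := by
  have : M = Matrix.diagonal fun _ => M 0 0 := by
    ext i j
    fin_cases i
    fin_cases j
    simp
  rw [this, Matrix.l2_opNorm_diagonal, Matrix.diagonal_apply_eq]
  simp

theorem norm_blockOp_fin_one {H : Type*} [NormedAddCommGroup H] [InnerProductSpace ℂ H]
    (T : Matrix (Fin 1) (Fin 1) (H →L[ℂ] H)) : ‖blockOp T‖ = ‖T 0 0‖ := by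
  have key : ∀ c : ℝ, 0 ≤ c → (‖blockOp T‖ ≤ c ↔ ‖T 0 0‖ ≤ c) := by
    intro c hc
    rw [norm_blockOp_le_iff _ hc, ContinuousLinearMap.opNorm_le_iff hc]
    have e : ∀ y : H, ‖T 0 0 y‖ ^ 2 ≤ c ^ 2 * ‖y‖ ^ 2 ↔ ‖T 0 0 y‖ ≤ c * ‖y‖ := fun y => by
      rw [← mul_pow, sq_le_sq₀ (norm_nonneg _) (by positivity)]
    simp only [Finset.univ_unique, Fin.default_eq_zero, Finset.sum_singleton, e]
    exact ⟨fun h y => h fun _ => y, fun h x => h _⟩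
  exact le_antisymm ((key _ (norm_nonneg _)).2 le_rfl) ((key _ (blockOp T).opNorm_nonneg).1 le_rfl)

theorem homContractive_iff_homContractiveAt_one {H : Type*} [NormedAddCommGroup H]
    [InnerProductSpace ℂ H] (ρ : holo A →ₐ[ℂ] (H →L[ℂ] H)) :
    HomContractive ρ ↔ HomContractiveAt ρ 1 := by
  have key : ∀ F : Matrix (Fin 1) (Fin 1) (holo A),
      (‖blockOp (F.map ρ)‖ₑ ≤ supNorm A F ↔
        ‖ρ (F 0 0)‖ₑ ≤ ⨆ z ∈ unitBall A, ‖(F 0 0 : (Fin 2 → ℂ) → ℂ) z‖ₑ) := by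
    intro F
    have h1 : ‖blockOp (F.map ρ)‖ₑ = ‖ρ (F 0 0)‖ₑ := by
      rw [← ofReal_norm, norm_blockOp_fin_one, ofReal_norm]
      rfl
    have h2 : supNorm A F = ⨆ z ∈ unitBall A, ‖(F 0 0 : (Fin 2 → ℂ) → ℂ) z‖ₑ := by
      refine iSup_congr fun z => iSup_congr fun _ => ?_
      rw [← ofReal_norm, norm_matrix_fin_one, ofReal_norm]
      rfl
    rw [h1, h2]
  exact ⟨fun h F => (key F).2 (h _), fun h f => (key (Matrix.of fun _ _ => f)).1 (h _)⟩

theorem linContractive_iff_linContractiveAt_one {p q : ℕ} (V : Fin 2 → Matrix (Fin p) (Fin q) ℂ) :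
    LinContractive A V ↔ LinContractiveAt A V 1 := by
  have key : ∀ Θ : Fin 2 → Matrix (Fin 1) (Fin 1) ℂ,
      (‖linMapAt V Θ‖ₑ ≤ dualNormAt A Θ ↔
        ‖linMap V (fun l => Θ l 0 0)‖ₑ ≤ dualNorm A (fun l => Θ l 0 0)) := by
    intro Θ
    have h1 : linMapAt V Θ = (linMap V (fun l => Θ l 0 0)).submatrix
        (Equiv.uniqueProd (Fin p) (Fin 1)) (Equiv.uniqueProd (Fin q) (Fin 1)) := by
      ext ⟨i, a⟩ ⟨j, b⟩
      obtain rfl := Subsingleton.elim i 0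
      obtain rfl := Subsingleton.elim j 0
      simp [linMapAt, linMap_apply]
    have h2 : dualNormAt A Θ = dualNorm A (fun l => Θ l 0 0) := by
      refine iSup_congr fun z => iSup_congr fun _ => ?_
      rw [← ofReal_norm, norm_matrix_fin_one, ofReal_norm]
      simp [mul_comm]
    rw [h1, h2, ← ofReal_norm, l2_opNorm_submatrix_equiv, ofReal_norm]
  exact ⟨fun h Θ => (key Θ).2 (h _), fun h w => (key fun l => Matrix.of fun _ _ => w l).1 (h _)⟩

theorem homContractive_rho_iff {p q : ℕ} (V : Fin 2 → Matrix (Fin p) (Fin q) ℂ) :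
    HomContractive (rho A V) ↔ LinContractive A V := by
  rw [homContractive_iff_homContractiveAt_one, linContractive_iff_linContractiveAt_one,
    homContractiveAt_rho_iff]

theorem homCompletelyContractive_rho_iff {p q : ℕ} (V : Fin 2 → Matrix (Fin p) (Fin q) ℂ) :
    HomCompletelyContractive (rho A V) ↔ LinCompletelyContractive A V :=
  forall₂_congr fun _ _ => homContractiveAt_rho_iff V

end BallHom

namespace BallHom

/-! ### Normal form of a pair under unitary equivalence -/

section Unitary

open Matrix

theorem norm_le_one_of_conjTranspose_mul_self {n : Type*} [Fintype n] [DecidableEq n]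
    {X : Matrix n n ℂ} (h : X.conjTranspose * X = 1) : ‖X‖ ≤ 1 := by
  open scoped ComplexOrder in
  rw [norm_le_one_iff_posSemidef, h, sub_self]
  exact Matrix.PosSemidef.zero

theorem norm_unitary_le_one {n : Type*} [Fintype n] [DecidableEq n] {U : Matrix n n ℂ}
    (hU : U ∈ unitaryGroup n ℂ) : ‖U‖ ≤ 1 :=
  norm_le_one_of_conjTranspose_mul_self (mem_unitaryGroup_iff'.1 hU)

theorem norm_mul_mul_le_of_norm_le_one {m n m' n' : Type*} [Fintype m] [DecidableEq m] [Fintype n]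
    [DecidableEq n] [Fintype m'] [DecidableEq m'] [Fintype n'] [DecidableEq n'] {U : Matrix m' m ℂ}
    {W : Matrix n n' ℂ} (hU : ‖U‖ ≤ 1) (hW : ‖W‖ ≤ 1) (X : Matrix m n ℂ) :
    ‖U * X * W‖ ≤ ‖X‖ := by
  calc ‖U * X * W‖ ≤ ‖U * X‖ * ‖W‖ := l2_opNorm_mul _ _
    _ ≤ (‖U‖ * ‖X‖) * ‖W‖ := by gcongr; exact l2_opNorm_mul _ _
    _ ≤ (1 * ‖X‖) * 1 := by gcongr
    _ = ‖X‖ := by ring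

theorem norm_unitary_mul_mul_unitary {n : Type*} [Fintype n] [DecidableEq n] {U W : Matrix n n ℂ}
    (hU : U ∈ unitaryGroup n ℂ) (hW : W ∈ unitaryGroup n ℂ) (X : Matrix n n ℂ) :
    ‖U * X * W‖ = ‖X‖ := by
  refine le_antisymm
    (norm_mul_mul_le_of_norm_le_one (norm_unitary_le_one hU) (norm_unitary_le_one hW) X) ?_
  have e : X = star U * (U * X * W) * star W := by
    rw [← Matrix.mul_assoc, ← Matrix.mul_assoc, mem_unitaryGroup_iff'.1 hU, Matrix.one_mul,
      Matrix.mul_assoc, mem_unitaryGroup_iff.1 hW, Matrix.mul_one]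
  conv_lhs => rw [e]
  exact norm_mul_mul_le_of_norm_le_one (norm_unitary_le_one (Unitary.star_mem hU))
    (norm_unitary_le_one (Unitary.star_mem hW)) _

theorem swap_mem_unitaryGroup :
    (!![0, 1; 1, 0] : Matrix (Fin 2) (Fin 2) ℂ) ∈ unitaryGroup (Fin 2) ℂ := by
  rw [mem_unitaryGroup_iff]
  ext i j
  fin_cases i <;> fin_cases j <;> simp [Matrix.mul_apply, star_eq_conjTranspose]

/-- The unitary rotates `(a, b)` onto the first axis, hence its orthogonal complement onto the
second. -/
theorem exists_unitary_mulVec_eq_zero (a b : ℂ) (h : a ≠ 0 ∨ b ≠ 0) :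
    ∃ U ∈ unitaryGroup (Fin 2) ℂ, U 1 0 * a + U 1 1 * b = 0 ∧
      ∀ x y : ℂ, star a * x + star b * y = 0 → U 0 0 * x + U 0 1 * y = 0 := by
  set r : ℝ := √(‖a‖ ^ 2 + ‖b‖ ^ 2) with hr
  have hpos : 0 < ‖a‖ ^ 2 + ‖b‖ ^ 2 := by
    rcases h with h | h
    · have := norm_pos_iff.2 h
      positivity
    · have := norm_pos_iff.2 h
      positivity
  have hr0 : (r : ℂ) ≠ 0 := by exact_mod_cast (Real.sqrt_pos.2 hpos).ne'
  have hr2 : (r : ℂ) ^ 2 = star a * a + star b * b := by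
    have : r ^ 2 = ‖a‖ ^ 2 + ‖b‖ ^ 2 := Real.sq_sqrt hpos.le
    have h1 : star a * a = ((‖a‖ ^ 2 : ℝ) : ℂ) := by simp [Complex.conj_mul']
    have h2 : star b * b = ((‖b‖ ^ 2 : ℝ) : ℂ) := by simp [Complex.conj_mul']
    rw [h1, h2]
    exact_mod_cast this
  have hsr : (starRingEnd ℂ) (r : ℂ) = r := Complex.conj_ofReal r
  refine ⟨!![star a / r, star b / r; -b / r, a / r], ?_, ?_, ?_⟩
  · rw [mem_unitaryGroup_iff]
    ext i j
    fin_cases i <;> fin_cases j <;>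
      simp [Matrix.mul_apply, star_eq_conjTranspose, hsr, Fin.sum_univ_two] <;>
      (field_simp; simp [hr2] <;> ring)
  · simp
    field_simp
    ring
  · intro x y hxy
    simp only [of_apply, cons_val', cons_val_zero, cons_val_one, cons_val_fin_one]
    field_simp
    exact hxy.trans (mul_zero _).symm

theorem isDiag_fin_two {X : Matrix (Fin 2) (Fin 2) ℂ} (h1 : X 0 1 = 0) (h2 : X 1 0 = 0) :
    X.IsDiag := by
  intro i j hij
  fin_cases i <;> fin_cases j
  · exact absurd rfl hij
  · exact h1
  · exact h2
  · exact absurd rfl hij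

/-- The columns of `C` are orthogonal, so a unitary rotating a nonzero column onto its axis puts the
other column on the other axis. If the first column vanishes, a swap moves the second one to the
second axis. -/
theorem exists_unitary_mul_isDiag {C : Matrix (Fin 2) (Fin 2) ℂ}
    (hC : (C.conjTranspose * C).IsDiag) :
    ∃ U ∈ unitaryGroup (Fin 2) ℂ, (U * C).IsDiag := by
  have h01 : star (C 0 0) * C 0 1 + star (C 1 0) * C 1 1 = 0 := by
    have := hC (show (0 : Fin 2) ≠ 1 by decide)
    simpa [Matrix.mul_apply, Fin.sum_univ_two] using this
  by_cases h0 : C 0 0 ≠ 0 ∨ C 1 0 ≠ 0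
  · obtain ⟨U, hU, h1, h2⟩ := exists_unitary_mulVec_eq_zero _ _ h0
    refine ⟨U, hU, isDiag_fin_two ?_ ?_⟩
    · simpa [Matrix.mul_apply, Fin.sum_univ_two] using h2 _ _ h01
    · simpa [Matrix.mul_apply, Fin.sum_univ_two] using h1
  · push Not at h0
    by_cases h1 : C 0 1 ≠ 0 ∨ C 1 1 ≠ 0
    · obtain ⟨U, hU, h2, -⟩ := exists_unitary_mulVec_eq_zero _ _ h1
      refine ⟨!![0, 1; 1, 0] * U, mul_mem swap_mem_unitaryGroup hU, isDiag_fin_two ?_ ?_⟩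
      · simpa [Matrix.mul_apply, Fin.sum_univ_two, vecMul, dotProduct] using h2
      · simp [Matrix.mul_apply, Fin.sum_univ_two, h0.1, h0.2]
    · push Not at h1
      exact ⟨1, one_mem _, isDiag_fin_two (by simpa using h1.1) (by simpa using h0.2)⟩

/-- Singular value decomposition of a `2 × 2` matrix. -/
theorem exists_unitary_mul_mul_isDiag (B : Matrix (Fin 2) (Fin 2) ℂ) :
    ∃ U ∈ unitaryGroup (Fin 2) ℂ, ∃ W ∈ unitaryGroup (Fin 2) ℂ, (U * B * W).IsDiag := by
  have hH : (B.conjTranspose * B).IsHermitian := isHermitian_conjTranspose_mul_self B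
  set W := (hH.eigenvectorUnitary : Matrix (Fin 2) (Fin 2) ℂ) with hW
  have hWu : W ∈ unitaryGroup (Fin 2) ℂ := hH.eigenvectorUnitary.2
  -- An eigenbasis of `B* B` makes the columns of `B W` orthogonal.
  have h1 : (B * W).conjTranspose * (B * W) = diagonal (RCLike.ofReal ∘ hH.eigenvalues) := by
    have := hH.conjStarAlgAut_star_eigenvectorUnitary
    rw [Unitary.conjStarAlgAut_star_apply] at this
    rw [conjTranspose_mul, ← this, hW]
    simp only [Matrix.mul_assoc]
    rfl
  obtain ⟨U, hU, hd⟩ := exists_unitary_mul_isDiag (C := B * W) (by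
    rw [h1]
    exact isDiag_diagonal _)
  exact ⟨U, hU, W, hWu, by rwa [Matrix.mul_assoc]⟩

theorem exists_unitary_mul_mul_eq_single {B : Matrix (Fin 2) (Fin 2) ℂ} (hB : B.det = 0) :
    ∃ U ∈ unitaryGroup (Fin 2) ℂ, ∃ W ∈ unitaryGroup (Fin 2) ℂ, ∃ t : ℂ,
      U * B * W = !![t, 0; 0, 0] := by
  obtain ⟨U, hU, W, hW, hd⟩ := exists_unitary_mul_mul_isDiag B
  have h01 : (U * B * W) 0 1 = 0 := hd (by decide)
  have h10 : (U * B * W) 1 0 = 0 := hd (by decide)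
  have hdet : (U * B * W) 0 0 * (U * B * W) 1 1 = 0 := by
    have : (U * B * W).det = 0 := by simp [det_mul, hB]
    rwa [det_fin_two, h01, zero_mul, sub_zero] at this
  rcases mul_eq_zero.1 hdet with h | h
  · refine ⟨!![0, 1; 1, 0] * U, mul_mem swap_mem_unitaryGroup hU, W * !![0, 1; 1, 0],
      mul_mem hW swap_mem_unitaryGroup, (U * B * W) 1 1, ?_⟩
    have e : !![0, 1; 1, 0] * U * B * (W * !![0, 1; 1, 0])
        = !![0, 1; 1, 0] * (U * B * W) * !![0, 1; 1, 0] := by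
      simp only [Matrix.mul_assoc]
    rw [e, (eta_fin_two (U * B * W)), h, h01, h10]
    ext i j
    fin_cases i <;> fin_cases j <;> simp
  · refine ⟨U, hU, W, hW, (U * B * W) 0 0, ?_⟩
    conv_lhs => rw [eta_fin_two (U * B * W), h, h01, h10]

variable {A : Fin 2 → Matrix (Fin 2) (Fin 2) ℂ}

/-- If the matrices are dependent, both are multiples of one matrix, and its singular value
decomposition diagonalizes both. -/
theorem linearIndependent_of_not_simultaneouslyDiagonalizable
    (hA : ¬ SimultaneouslyDiagonalizable A) : LinearIndependent ℂ A := by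
  by_contra h
  rw [Fintype.linearIndependent_iff] at h
  push Not at h
  obtain ⟨c, hc, i, hi⟩ := h
  rw [Fin.sum_univ_two] at hc
  obtain ⟨B, x, hB⟩ : ∃ (B : Matrix (Fin 2) (Fin 2) ℂ) (x : Fin 2 → ℂ), ∀ i, A i = x i • B := by
    fin_cases i
    · refine ⟨A 1, ![-(c 0)⁻¹ * c 1, 1], fun i => ?_⟩
      fin_cases i
      · have : c 0 • A 0 = -(c 1 • A 1) := eq_neg_of_add_eq_zero_left hc
        have h2 : A 0 = (c 0)⁻¹ • (c 0 • A 0) := (inv_smul_smul₀ hi _).symm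
        simp only [Fin.zero_eta, cons_val_zero]
        rw [h2, this, smul_neg, smul_smul, neg_mul, neg_smul]
      · simp
    · refine ⟨A 0, ![1, -(c 1)⁻¹ * c 0], fun i => ?_⟩
      fin_cases i
      · simp
      · have : c 1 • A 1 = -(c 0 • A 0) := eq_neg_of_add_eq_zero_right hc
        have h2 : A 1 = (c 1)⁻¹ • (c 1 • A 1) := (inv_smul_smul₀ hi _).symm
        simp only [Fin.mk_one, cons_val_one, cons_val_fin_one]
        rw [h2, this, smul_neg, smul_smul, neg_mul, neg_smul]
  obtain ⟨U, hU, W, hW, hd⟩ := exists_unitary_mul_mul_isDiag B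
  refine hA ⟨U, hU, W, hW, fun i => ?_⟩
  rw [hB, Matrix.mul_smul, Matrix.smul_mul]
  exact hd.smul _

theorem exists_det_eq_zero (A : Fin 2 → Matrix (Fin 2) (Fin 2) ℂ) :
    ∃ c : Fin 2 → ℂ, c ≠ 0 ∧ (∑ i, c i • A i).det = 0 := by
  by_cases h : (A 0).det = 0
  · exact ⟨![1, 0], fun h0 => one_ne_zero (congrFun h0 0), by simpa using h⟩
  -- `det (x A₀ + A₁)` is a quadratic polynomial in `x` with leading coefficient `det A₀ ≠ 0`, so it
  -- has a root.
  · obtain ⟨s, hs⟩ := IsAlgClosed.exists_pow_nat_eq (discrim (A 0).det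
      (A 0 0 0 * A 1 1 1 + A 1 0 0 * A 0 1 1 - A 0 0 1 * A 1 1 0 - A 1 0 1 * A 0 1 0)
      (A 1).det) (n := 2) (by norm_num)
    obtain ⟨x, hx⟩ := exists_quadratic_eq_zero h ⟨s, by rw [← hs, sq]⟩
    refine ⟨![x, 1], fun h0 => one_ne_zero (congrFun h0 1), ?_⟩
    rw [← hx]
    simp [det_fin_two]
    ring

/-- Normal form of a pair that is not simultaneously diagonalizable: up to unitary equivalence
its span contains a matrix unit, and a matrix with a nonzero off-diagonal entry. -/
theorem exists_normal_form (hA : ¬ SimultaneouslyDiagonalizable A) :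
    ∃ U ∈ unitaryGroup (Fin 2) ℂ, ∃ W ∈ unitaryGroup (Fin 2) ℂ, ∃ c d : Fin 2 → ℂ,
      U * (∑ i, c i • A i) * W = !![1, 0; 0, 0] ∧ (U * (∑ i, d i • A i) * W) 0 0 = 0 ∧
      ((U * (∑ i, d i • A i) * W) 0 1 ≠ 0 ∨ (U * (∑ i, d i • A i) * W) 1 0 ≠ 0) := by
  have hLI := linearIndependent_of_not_simultaneouslyDiagonalizable hA
  obtain ⟨c, hc, hdet⟩ := exists_det_eq_zero A
  obtain ⟨U, hU, W, hW, t, ht⟩ := exists_unitary_mul_mul_eq_single hdet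
  have ht0 : t ≠ 0 := by
    rintro rfl
    have h0 : ‖∑ i, c i • A i‖ = 0 := by
      rw [← norm_unitary_mul_mul_unitary hU hW, ht, norm_eq_zero]
      ext i j
      fin_cases i <;> fin_cases j <;> rfl
    exact hc (funext (Fintype.linearIndependent_iff.1 hLI c (norm_eq_zero.1 h0)))
  have hsum : ∀ e : Fin 2 → ℂ, U * (∑ i, e i • A i) * W = ∑ i, e i • (U * A i * W) := by
    intro e
    simp only [Matrix.mul_sum, Matrix.sum_mul, Matrix.mul_smul, Matrix.smul_mul]
  have hcd : ∀ i j, ∑ l, c l * (U * A l * W) i j = (!![t, 0; 0, 0] : Matrix _ _ ℂ) i j := by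
    intro i j
    rw [← ht, hsum, Matrix.sum_apply]
    rfl
  have hcB : U * (∑ i, (t⁻¹ • c) i • A i) * W = !![1, 0; 0, 0] := by
    have : ∑ i, (t⁻¹ • c) i • A i = t⁻¹ • ∑ i, c i • A i := by
      simp [smul_smul]
    rw [this, Matrix.mul_smul, Matrix.smul_mul, ht]
    ext i j
    fin_cases i <;> fin_cases j <;> simp [ht0]
  refine ⟨U, hU, W, hW, t⁻¹ • c, ?_⟩
  by_contra hcon
  push Not at hcon
  -- Subtracting `lam` times the combination that gives `E₁₁` kills the first entry and leaves the
  -- off-diagonal entries unchanged. Under the negated claim these vanish for every `d`, in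
  -- particular for each `A l`.
  have key : ∀ d : Fin 2 → ℂ, (∀ i j, i ≠ j → ∑ l, d l * (U * A l * W) i j = 0) := by
    intro d
    set lam : ℂ := ∑ l, d l * (U * A l * W) 0 0 with hlam
    have hB : ∀ i j, (U * (∑ i, (d - lam • t⁻¹ • c) i • A i) * W) i j
        = ∑ l, d l * (U * A l * W) i j - lam * t⁻¹ * ∑ l, c l * (U * A l * W) i j := by
      intro i j
      rw [hsum, Matrix.sum_apply]
      simp only [Fin.sum_univ_two, Matrix.smul_apply, Pi.sub_apply, Pi.smul_apply, smul_eq_mul]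
      ring
    have h2 := hcon (d - lam • t⁻¹ • c) hcB (by
      rw [hB, hcd, ← hlam]
      simp [ht0])
    rw [hB, hB, hcd, hcd] at h2
    intro i j hij
    fin_cases i <;> fin_cases j
    · exact absurd rfl hij
    · simpa using h2.1
    · simpa using h2.2
    · exact absurd rfl hij
  refine hA ⟨U, hU, W, hW, fun l i j hij => ?_⟩
  have := key (Pi.single l 1) i j hij
  simpa [Pi.single_apply] using this

end Unitary

end BallHom

namespace BallHom

/-! ### A contractive linear map that fails at the second matrix level -/

section NotCompletelyContractive

open Matrix

variable {A : Fin 2 → Matrix (Fin 2) (Fin 2) ℂ}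

/-- The supremum over the open ball controls the closed ball by letting `t z` tend to `z` as `t`
increases to `1`. -/
theorem enorm_le_dualNorm {z : Fin 2 → ℂ} (hz : normA A z ≤ 1) (w : Fin 2 → ℂ) :
    ‖∑ i, w i * z i‖ₑ ≤ dualNorm A w := by
  have hc : Continuous fun t : ℝ => ‖∑ i, w i * ((t : ℂ) • z) i‖ₑ := by
    refine continuous_enorm.comp ?_
    simp only [Pi.smul_apply, smul_eq_mul]
    fun_prop
  have ht := (hc.tendsto 1).mono_left (nhdsWithin_le_nhds (s := Set.Iio 1))
  simp only [Complex.ofReal_one, one_smul] at ht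
  refine le_of_tendsto ht ?_
  filter_upwards [Ioo_mem_nhdsLT (show (0 : ℝ) < 1 by norm_num)] with t htt
  refine le_iSup₂ (f := fun z (_ : z ∈ unitBall A) => ‖∑ i, w i * z i‖ₑ) ((t : ℂ) • z) ?_
  change normA A _ < 1
  rw [normA_smul, Complex.norm_real, Real.norm_of_nonneg htt.1.le]
  calc t * normA A z ≤ t * 1 := by gcongr; exact htt.1.le
    _ < 1 := by linarith [htt.2]

theorem linMap_row (c d w : Fin 2 → ℂ) :
    linMap (fun i => (!![c i, d i] : Matrix (Fin 1) (Fin 2) ℂ)) w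
      = !![∑ i, w i * c i, ∑ i, w i * d i] := by
  ext i j
  fin_cases i
  fin_cases j <;> simp [linMap_apply]

theorem norm_row_le (α β : ℂ) {r : ℝ} (hr : 0 ≤ r) (h : ‖α‖ ^ 2 + ‖β‖ ^ 2 ≤ r ^ 2) :
    ‖(!![α, β] : Matrix (Fin 1) (Fin 2) ℂ)‖ ≤ r := by
  rw [l2_opNorm_le_iff _ hr]
  intro x
  simp only [Fin.sum_univ_two, Finset.univ_unique, Fin.default_eq_zero, Finset.sum_singleton]
  have h1 : (!![α, β] *ᵥ x) 0 = α * x 0 + β * x 1 := by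
    simp [mulVec, dotProduct]
  rw [h1]
  have h2 : ‖α * x 0 + β * x 1‖ ≤ ‖α‖ * ‖x 0‖ + ‖β‖ * ‖x 1‖ :=
    (norm_add_le _ _).trans (by simp)
  calc ‖α * x 0 + β * x 1‖ ^ 2 ≤ (‖α‖ * ‖x 0‖ + ‖β‖ * ‖x 1‖) ^ 2 := by gcongr
    _ ≤ (‖α‖ ^ 2 + ‖β‖ ^ 2) * (‖x 0‖ ^ 2 + ‖x 1‖ ^ 2) := by
        nlinarith [sq_nonneg (‖α‖ * ‖x 1‖ - ‖β‖ * ‖x 0‖)]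
    _ ≤ r ^ 2 * (‖x 0‖ ^ 2 + ‖x 1‖ ^ 2) := by gcongr

/-- If all combinations `u₀ c + u₁ d` with `|u₀|² + |u₁|² ≤ 1` lie in the closed ball, then the
rows `(cᵢ, dᵢ)` define a contraction. -/
theorem linContractive_row {c d : Fin 2 → ℂ}
    (h : ∀ u v : ℂ, ‖u‖ ^ 2 + ‖v‖ ^ 2 ≤ 1 → normA A (u • c + v • d) ≤ 1) :
    LinContractive A (fun i => (!![c i, d i] : Matrix (Fin 1) (Fin 2) ℂ)) := by
  intro w
  rw [linMap_row]
  set α := ∑ i, w i * c i with hα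
  set β := ∑ i, w i * d i with hβ
  set r := √(‖α‖ ^ 2 + ‖β‖ ^ 2) with hr
  have hr2 : r ^ 2 = ‖α‖ ^ 2 + ‖β‖ ^ 2 := Real.sq_sqrt (by positivity)
  have hr0 : 0 ≤ r := Real.sqrt_nonneg _
  have h1 : ‖(!![α, β] : Matrix (Fin 1) (Fin 2) ℂ)‖ₑ ≤ ‖(r : ℂ)‖ₑ := by
    rw [← ofReal_norm, ← ofReal_norm, Complex.norm_real, Real.norm_of_nonneg hr0]
    exact ENNReal.ofReal_le_ofReal (norm_row_le _ _ hr0 hr2.ge)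
  refine h1.trans ?_
  rcases hr0.eq_or_lt with h0 | hpos
  · simp [← h0]
  have hrC : (r : ℂ) ≠ 0 := by exact_mod_cast hpos.ne'
  -- The unit vector dual to `(α, β)`: pairing with it gives `r`.
  have hz := h (star α / r) (star β / r) (by
    simp only [norm_div, norm_star, Complex.norm_real, Real.norm_of_nonneg hr0, div_pow]
    rw [← add_div, ← hr2, div_self (by positivity)])
  have e : ∑ i, w i * ((star α / (r : ℂ)) • c + (star β / (r : ℂ)) • d) i = r := by
    have e1 : ∑ i, w i * ((star α / (r : ℂ)) • c + (star β / (r : ℂ)) • d) i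
        = (star α * α + star β * β) / r := by
      rw [hα, hβ]
      simp only [Fin.sum_univ_two, Pi.add_apply, Pi.smul_apply, smul_eq_mul]
      ring
    have e2 : star α * α + star β * β = (r : ℂ) ^ 2 := by
      have h1 : star α * α = ((‖α‖ ^ 2 : ℝ) : ℂ) := by simp [Complex.conj_mul']
      have h2 : star β * β = ((‖β‖ ^ 2 : ℝ) : ℂ) := by simp [Complex.conj_mul']
      rw [h1, h2]
      exact_mod_cast hr2.symm
    rw [e1, e2]
    field_simp
  have := enorm_le_dualNorm hz w
  rwa [e] at this

/-- The first entry is exactly `u`, and with `t = ‖v‖ K` all others are at most `t`, where `9 t² ≤ 1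
- ‖u‖²` by the factor `3`. The cross term is absorbed by `2 t a e ≤ 4 t² a² + e² / 4`; this leaves
coefficients at most `1 - 3 t²` of `a²` and `1/4 + 3 t² ≤ 7/12` of `e²`. -/
theorem norm_le_one_of_scaled (b c d u v : ℂ) {s : ℝ} (hs : 3 * (‖b‖ + ‖c‖ + ‖d‖) ≤ s)
    (huv : ‖u‖ ^ 2 + s ^ 2 * ‖v‖ ^ 2 ≤ 1) :
    ‖(!![u, v * b; v * c, v * d] : Matrix (Fin 2) (Fin 2) ℂ)‖ ≤ 1 := by
  rw [l2_opNorm_le_iff _ zero_le_one]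
  intro x
  set K := ‖b‖ + ‖c‖ + ‖d‖ with hK
  have hb := norm_nonneg b
  have hc := norm_nonneg c
  have hd := norm_nonneg d
  have hK0 : 0 ≤ K := by positivity
  simp only [Fin.sum_univ_two]
  have h0 : (!![u, v * b; v * c, v * d] *ᵥ x) 0 = u * x 0 + v * b * x 1 := by
    simp [mulVec, dotProduct]
  have h1 : (!![u, v * b; v * c, v * d] *ᵥ x) 1 = v * c * x 0 + v * d * x 1 := by
    simp [mulVec, dotProduct]
  rw [h0, h1]
  set a := ‖x 0‖ with ha
  set e := ‖x 1‖ with he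
  set t := ‖v‖ * K with ht
  have ha0 : 0 ≤ a := norm_nonneg _
  have he0 : 0 ≤ e := norm_nonneg _
  have ht0 : 0 ≤ t := by positivity
  have h2 : ‖u * x 0 + v * b * x 1‖ ≤ ‖u‖ * a + t * e := by
    refine (norm_add_le _ _).trans ?_
    simp only [norm_mul]
    gcongr
    rw [ht]
    gcongr
    linarith
  have h3 : ‖v * c * x 0 + v * d * x 1‖ ≤ t * a + t * e := by
    refine (norm_add_le _ _).trans ?_
    simp only [norm_mul]
    rw [ht]
    gcongr <;> linarith
  have h4 : 9 * t ^ 2 ≤ s ^ 2 * ‖v‖ ^ 2 := by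
    have : (3 * K) ^ 2 ≤ s ^ 2 := by gcongr
    calc 9 * t ^ 2 = (3 * K) ^ 2 * ‖v‖ ^ 2 := by rw [ht]; ring
      _ ≤ s ^ 2 * ‖v‖ ^ 2 := by gcongr
  have hu0 := norm_nonneg u
  have hu : ‖u‖ ^ 2 ≤ 1 - 9 * t ^ 2 := by linarith
  have hu1 : ‖u‖ ≤ 1 := by nlinarith
  have h5 : 9 * t ^ 2 ≤ 1 := by nlinarith
  calc ‖u * x 0 + v * b * x 1‖ ^ 2 + ‖v * c * x 0 + v * d * x 1‖ ^ 2
      ≤ (‖u‖ * a + t * e) ^ 2 + (t * a + t * e) ^ 2 := by gcongr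
    _ = ‖u‖ ^ 2 * a ^ 2 + 2 * (‖u‖ * (t * a * e)) + t ^ 2 * e ^ 2 + t ^ 2 * (a + e) ^ 2 := by ring
    _ ≤ (1 - 9 * t ^ 2) * a ^ 2 + 2 * (1 * (t * a * e)) + t ^ 2 * e ^ 2
        + t ^ 2 * (2 * (a ^ 2 + e ^ 2)) := by
        gcongr
        nlinarith [sq_nonneg (a - e)]
    _ ≤ 1 ^ 2 * (a ^ 2 + e ^ 2) := by
        nlinarith [sq_nonneg (2 * t * a - e / 2), sq_nonneg (t * a), sq_nonneg e,
          mul_le_mul_of_nonneg_right h5 (sq_nonneg e)]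

/-- The test element is `Θ = A`. Up to unitaries its image is the block row `[E₁₁, M]`, whose first
row contains `1` and `β`. The vector with entries `1` and `star β` in these two places has squared
norm `1 + |β|²`, while the first component of its image is `1 + |β|²`. -/
theorem not_linContractiveAt_row {U W : Matrix (Fin 2) (Fin 2) ℂ}
    (hU : U ∈ unitaryGroup (Fin 2) ℂ) (hW : W ∈ unitaryGroup (Fin 2) ℂ) {c d : Fin 2 → ℂ}
    (hc : U * (∑ i, c i • A i) * W = !![1, 0; 0, 0])
    (hd : (U * (∑ i, d i • A i) * W) 0 1 ≠ 0) :
    ¬ LinContractiveAt A (fun i => (!![c i, d i] : Matrix (Fin 1) (Fin 2) ℂ)) 2 := by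
  intro h
  set V : Fin 2 → Matrix (Fin 1) (Fin 2) ℂ := fun i => !![c i, d i] with hV
  obtain ⟨M, hM⟩ : ∃ M, M = U * (∑ i, d i • A i) * W := ⟨_, rfl⟩
  rw [← hM] at hd
  set β := M 0 1 with hβ
  have h1 : ‖linMapAt V A‖ ≤ 1 := by
    rw [← enorm_le_one_iff]
    refine (h A).trans (iSup₂_le fun z hz => ?_)
    exact enorm_le_one_iff.2 (le_of_lt (show normA A z < 1 from hz))
  have hkron : ∀ {X : Matrix (Fin 2) (Fin 2) ℂ} (p : ℕ), X ∈ unitaryGroup (Fin 2) ℂ →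
      ‖X ⊗ₖ (1 : Matrix (Fin p) (Fin p) ℂ)‖ ≤ 1 := by
    intro X p hX
    refine norm_le_one_of_conjTranspose_mul_self ?_
    rw [conjTranspose_kronecker, ← mul_kronecker_mul, ← star_eq_conjTranspose,
      mem_unitaryGroup_iff'.1 hX]
    simp
  have h2 : ‖linMapAt V (fun l => U * A l * W)‖ ≤ 1 := by
    rw [linMapAt_mul_mul]
    exact (norm_mul_mul_le_of_norm_le_one (hkron 1 hU) (hkron 2 hW) _).trans h1
  have hsum : ∀ (e : Fin 2 → ℂ) (i j : Fin 2), ∑ l, e l * (U * A l * W) i j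
      = (U * (∑ i, e i • A i) * W) i j := by
    intro e i j
    simp only [Matrix.mul_sum, Matrix.sum_mul, Matrix.mul_smul, Matrix.smul_mul, Matrix.sum_apply,
      Matrix.smul_apply, smul_eq_mul]
  have hcol0 : ∀ a b : Fin 2, linMapAt V (fun l => U * A l * W) (a, 0) (b, 0)
      = (!![1, 0; 0, 0] : Matrix (Fin 2) (Fin 2) ℂ) a b := by
    intro a b
    rw [← hc, ← hsum, linMapAt, Matrix.sum_apply]
    refine Finset.sum_congr rfl fun l _ => ?_
    rw [kroneckerMap_apply, mul_comm]
    rfl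
  have hcol1 : ∀ a b : Fin 2, linMapAt V (fun l => U * A l * W) (a, 0) (b, 1) = M a b := by
    intro a b
    rw [hM, ← hsum, linMapAt, Matrix.sum_apply]
    refine Finset.sum_congr rfl fun l _ => ?_
    rw [kroneckerMap_apply, mul_comm]
    rfl
  have h3 := (l2_opNorm_le_iff _ zero_le_one).1 h2
    fun b => if b = (0, 0) then 1 else if b = (1, 1) then star β else 0
  set y := (linMapAt V (fun l => U * A l * W)).mulVec
    (fun b => if b = (0, 0) then 1 else if b = (1, 1) then star β else 0) with hy
  have hy0 : y (0, 0) = ((1 + ‖β‖ ^ 2 : ℝ) : ℂ) := by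
    have : β * star β = ((‖β‖ ^ 2 : ℝ) : ℂ) := by simp [Complex.mul_conj']
    rw [hy, mulVec, dotProduct, Fintype.sum_prod_type]
    simp only [Fin.sum_univ_two, hcol0, hcol1]
    simp only [Prod.mk.injEq, Fin.isValue, of_apply, cons_val', cons_val_zero, cons_val_one,
      cons_val_fin_one, and_self, if_true, mul_one, zero_ne_one, one_ne_zero, and_false, false_and,
      if_false, mul_zero, add_zero, zero_add]
    rw [← hβ, this]
    push_cast
    ring
  have hβ0 : 0 < ‖β‖ ^ 2 := by
    have := norm_pos_iff.2 hd
    positivity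
  have h4 : ‖y (0, 0)‖ ^ 2 ≤ ∑ i, ‖y i‖ ^ 2 :=
    Finset.single_le_sum (f := fun i => ‖y i‖ ^ 2) (fun i _ => by positivity) (Finset.mem_univ _)
  have h5 := h4.trans h3
  rw [hy0, Complex.norm_real, Real.norm_of_nonneg (by positivity), Fintype.sum_prod_type] at h5
  simp [Fin.sum_univ_two] at h5
  nlinarith

theorem exists_row_of_normal_form {U W : Matrix (Fin 2) (Fin 2) ℂ}
    (hU : U ∈ unitaryGroup (Fin 2) ℂ) (hW : W ∈ unitaryGroup (Fin 2) ℂ) {c d : Fin 2 → ℂ}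
    (hc : U * (∑ i, c i • A i) * W = !![1, 0; 0, 0]) (hd0 : (U * (∑ i, d i • A i) * W) 0 0 = 0)
    (hd : (U * (∑ i, d i • A i) * W) 0 1 ≠ 0) :
    ∃ V : Fin 2 → Matrix (Fin 1) (Fin 2) ℂ, LinContractive A V ∧ ¬ LinContractiveAt A V 2 := by
  set M := U * (∑ i, d i • A i) * W with hM
  -- Dividing `d` by this `s` brings the unit Euclidean ball of weights into the closed ball, as
  -- `norm_le_one_of_scaled` requires.
  set s : ℝ := 3 * (‖M 0 1‖ + ‖M 1 0‖ + ‖M 1 1‖) with hs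
  have hs0 : 0 < s := by
    have := norm_pos_iff.2 hd
    positivity
  have hsC : (s : ℂ) ≠ 0 := by exact_mod_cast hs0.ne'
  have hlin : ∀ e e' : Fin 2 → ℂ, ∀ u v : ℂ, U * (∑ i, (u • e + v • e') i • A i) * W
      = u • (U * (∑ i, e i • A i) * W) + v • (U * (∑ i, e' i • A i) * W) := by
    intro e e' u v
    simp only [Matrix.mul_sum, Matrix.sum_mul, Matrix.mul_smul, Matrix.smul_mul, Pi.add_apply,
      Pi.smul_apply, add_smul, smul_assoc, Finset.sum_add_distrib, Finset.smul_sum,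
      Matrix.mul_add, Matrix.add_mul]
  refine ⟨fun i => !![c i, ((s : ℂ)⁻¹ • d) i], linContractive_row fun u v huv => ?_,
    not_linContractiveAt_row hU hW hc ?_⟩
  · rw [normA, ← norm_unitary_mul_mul_unitary hU hW, smul_smul, hlin, hc, ← hM]
    have e : u • (!![1, 0; 0, 0] : Matrix (Fin 2) (Fin 2) ℂ) + (v * (s : ℂ)⁻¹) • M
        = !![u, v * (s : ℂ)⁻¹ * M 0 1; v * (s : ℂ)⁻¹ * M 1 0, v * (s : ℂ)⁻¹ * M 1 1] := by
      ext i j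
      fin_cases i <;> fin_cases j <;> simp [hd0]
    rw [e]
    refine norm_le_one_of_scaled _ _ _ _ _ le_rfl ?_
    rw [norm_mul, norm_inv, Complex.norm_real, Real.norm_of_nonneg hs0.le, ← hs, mul_pow ‖v‖,
      inv_pow]
    have : s ^ 2 * (‖v‖ ^ 2 * (s ^ 2)⁻¹) = ‖v‖ ^ 2 := by field_simp
    rw [this]
    exact huv
  · have := hlin 0 d 0 (s : ℂ)⁻¹
    rw [zero_smul, zero_smul, zero_add, zero_add] at this
    rw [this, ← hM, Matrix.smul_apply]
    exact smul_ne_zero (inv_ne_zero hsC) hd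

theorem normA_transpose : normA (fun i => (A i).transpose) = normA A := by
  have key : ∀ X : Matrix (Fin 2) (Fin 2) ℂ, ‖X.transpose‖ ≤ ‖X‖ := by
    intro X
    rw [← l2_opNorm_conjTranspose X, l2_opNorm_le_iff _ (norm_nonneg _)]
    intro x
    have h := sum_norm_sq_mulVec_le X.conjTranspose (star x)
    have e : X.conjTranspose.mulVec (star x) = star (X.transpose.mulVec x) := by
      rw [star_mulVec, ← mulVec_transpose]
      rfl
    rw [e] at h
    simpa using h
  funext z
  have e : ∑ i, z i • (A i).transpose = (∑ i, z i • A i).transpose := by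
    simp
  rw [normA, normA, e]
  refine le_antisymm (key _) ?_
  simpa using key (∑ i, z i • A i).transpose

/-- A pair that is not simultaneously diagonalizable admits a contractive linear map that is not
completely contractive. -/
theorem exists_linContractive_not_linContractiveAt (hA : ¬ SimultaneouslyDiagonalizable A) :
    ∃ V : Fin 2 → Matrix (Fin 1) (Fin 2) ℂ, LinContractive A V ∧ ¬ LinContractiveAt A V 2 := by
  obtain ⟨U, hU, W, hW, c, d, hc, hd0, hd | hd⟩ := exists_normal_form hA
  · exact exists_row_of_normal_form hU hW hc hd0 hd
  -- Transposition moves the nonzero entry to position `(0, 1)` and preserves the ball. Both notions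
  -- of contractivity of `L_V` see `A` through its ball alone, so the same `V` serves for `A`.
  · have htr : ∀ {X : Matrix (Fin 2) (Fin 2) ℂ}, X ∈ unitaryGroup (Fin 2) ℂ →
        X.transpose ∈ unitaryGroup (Fin 2) ℂ := by
      intro X hX
      rw [mem_unitaryGroup_iff', star_eq_conjTranspose, conjTranspose, transpose_transpose]
      have := congrArg transpose (mem_unitaryGroup_iff.1 hX)
      rw [transpose_mul, transpose_one, star_eq_conjTranspose] at this
      exact this
    have hT : ∀ e : Fin 2 → ℂ, W.transpose * (∑ i, e i • (A i).transpose) * U.transpose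
        = (U * (∑ i, e i • A i) * W).transpose := by
      intro e
      simp [transpose_mul, Matrix.mul_assoc]
    obtain ⟨V, h1, h2⟩ := exists_row_of_normal_form (A := fun i => (A i).transpose)
      (htr hW) (htr hU) (c := c) (d := d)
      (by
        rw [hT, hc]
        ext i j
        fin_cases i <;> fin_cases j <;> rfl)
      (by rw [hT]; exact hd0) (by rw [hT]; exact hd)
    have hb : unitBall (fun i => (A i).transpose) = unitBall A := by
      rw [unitBall, unitBall, normA_transpose]
    refine ⟨V, ?_, ?_⟩
    · simpa only [LinContractive, dualNorm, hb] using h1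
    · simpa only [LinContractiveAt, dualNormAt, hb] using h2

end NotCompletelyContractive

end BallHom

namespace BallHom

/-! ### Finite Fourier analysis and the von Neumann inequality for one isometry -/

section RootsOfUnity

variable {N : ℕ} {ζ : ℂ}

theorem sum_pow_mul_inv_pow (hζ : IsPrimitiveRoot ζ N) {a b : ℕ} (ha : a < N) (hb : b < N) :
    ∑ s : Fin N, ζ ^ (s.1 * a) * ζ⁻¹ ^ (s.1 * b) = if a = b then (N : ℂ) else 0 := by
  have hζ0 : ζ ≠ 0 := hζ.ne_zero (by omega)
  have h1 : ∀ s : Fin N, ζ ^ (s.1 * a) * ζ⁻¹ ^ (s.1 * b) = (ζ ^ a * ζ⁻¹ ^ b) ^ s.1 := by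
    intro s
    rw [mul_pow, ← pow_mul, ← pow_mul, mul_comm a, mul_comm b]
  simp only [h1]
  split_ifs with hab
  · subst hab
    rw [← mul_pow, mul_inv_cancel₀ hζ0]
    simp
  · rw [Fin.sum_univ_eq_sum_range fun s => (ζ ^ a * ζ⁻¹ ^ b) ^ s]
    have hne : ζ ^ a * ζ⁻¹ ^ b ≠ 1 := by
      intro h
      rw [inv_pow, mul_inv_eq_one₀ (pow_ne_zero _ hζ0)] at h
      exact hab (hζ.pow_inj ha hb h)
    rw [geom_sum_eq hne, mul_pow, ← pow_mul, ← pow_mul, mul_comm a, mul_comm b, pow_mul, pow_mul,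
      inv_pow ζ N, hζ.pow_eq_one]
    simp

theorem sum_norm_sq_of_conjTranspose_mul_self {X : Type*} [NormedAddCommGroup X]
    [InnerProductSpace ℂ X] {n : Type*} [Fintype n] [DecidableEq n] {M : Matrix n n ℂ} {c : ℝ}
    (hM : M.conjTranspose * M = (c : ℂ) • (1 : Matrix n n ℂ)) (x : n → X) :
    ∑ i, ‖∑ j, M i j • x j‖ ^ 2 = c * ∑ j, ‖x j‖ ^ 2 := by
  have h := inner_sum_smul_sum_smul M x
  rw [hM] at h
  refine Complex.ofReal_injective (h.trans ?_)
  simp [Matrix.smul_apply, Matrix.one_apply, inner_self_eq_norm_sq_to_K, Finset.mul_sum]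

/-- Parseval's identity for vector-valued functions on a finite cyclic group. -/
theorem sum_norm_sq_dft {X : Type*} [NormedAddCommGroup X] [InnerProductSpace ℂ X] (hN : N ≠ 0)
    (hζ : IsPrimitiveRoot ζ N) (x : Fin N → X) :
    ∑ s : Fin N, ‖∑ n : Fin N, ζ ^ (s.1 * n.1) • x n‖ ^ 2 = N * ∑ n, ‖x n‖ ^ 2 := by
  have hn : ‖ζ‖ = 1 := hζ.norm'_eq_one hN
  have hconj : star ζ = ζ⁻¹ := by
    rw [Complex.inv_def, Complex.normSq_eq_norm_sq, hn]
    simp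
  refine sum_norm_sq_of_conjTranspose_mul_self
    (M := Matrix.of fun s n : Fin N => ζ ^ (s.1 * n.1)) ?_ x
  ext a b
  rw [Matrix.mul_apply]
  have := sum_pow_mul_inv_pow hζ b.2 a.2
  simp only [Matrix.conjTranspose_apply, Matrix.of_apply, star_pow, hconj, Matrix.smul_apply,
    Matrix.one_apply, smul_eq_mul, mul_ite, mul_one, mul_zero]
  rw [← Finset.sum_congr rfl fun s _ => mul_comm _ _, this]
  simp [Fin.ext_iff, eq_comm]

end RootsOfUnity

section Isometry

variable {X : Type*} [NormedAddCommGroup X] [InnerProductSpace ℂ X]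

/-- The orbit `x, V x, ..., V^(N-1) x` with `N = L + M` is Fourier transformed over the `N`-th roots
of unity. There the operator polynomial acts by its values on the circle, each bounded by `C`.
Transforming back recovers `V^l y`, of norm `‖y‖`, for each `l < L`, and Parseval's identity
compares both sides. Only the `M` boundary terms are lost. -/
theorem isometry_window_bound (V : X →ₗᵢ[ℂ] X) {M : ℕ} (A : ℕ → X →ₗ[ℂ] X)
    (hcomm : ∀ a x, A a (V x) = V (A a x)) {C : ℝ}
    (hb : ∀ ω : ℂ, ‖ω‖ = 1 → ∀ x, ‖∑ a ∈ Finset.range M, ω ^ a • A a x‖ ≤ C * ‖x‖) (x : X)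
    (L : ℕ) :
    (L : ℝ) * ‖∑ a ∈ Finset.range M, A a ((V ^ a) x)‖ ^ 2 ≤ (L + M : ℝ) * (C ^ 2 * ‖x‖ ^ 2) := by
  rcases Nat.eq_zero_or_pos L with rfl | hL
  · simp
    positivity
  set N := L + M with hNdef
  have hN : N ≠ 0 := by omega
  set ζ := Complex.exp (2 * Real.pi * Complex.I / N) with hζdef
  have hζ : IsPrimitiveRoot ζ N := Complex.isPrimitiveRoot_exp N hN
  have hn : ‖ζ‖ = 1 := hζ.norm'_eq_one hN
  set y := ∑ a ∈ Finset.range M, A a ((V ^ a) x) with hy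
  have hcommpow : ∀ l a z, A a ((V ^ l) z) = (V ^ l) (A a z) := by
    intro l a
    induction l with
    | zero => intro z; simp
    | succ l ih => 
      intro z
      simp only [pow_succ, LinearIsometry.coe_mul, Function.comp_apply, ih, hcomm]
  set ξ : Fin N → X := fun s => ∑ n : Fin N, ζ⁻¹ ^ (s.1 * n.1) • (V ^ n.1) x with hξ
  set f : Fin N → X := fun s => ∑ a ∈ Finset.range M, (ζ ^ s.1) ^ a • A a (ξ s) with hf
  have h1 : ∑ s, ‖ξ s‖ ^ 2 = N * (N * ‖x‖ ^ 2) := by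
    rw [hξ, sum_norm_sq_dft hN hζ.inv]
    simp
  have h2 : ∀ s, ‖f s‖ ^ 2 ≤ C ^ 2 * ‖ξ s‖ ^ 2 := by
    intro s
    rw [← mul_pow]
    exact pow_le_pow_left₀ (norm_nonneg _) (hb _ (by rw [norm_pow, hn, one_pow]) _) 2
  -- For `l < L` and `a < M` the index `l + a` stays below `N`, so the cyclic convolution does not
  -- wrap around.
  have h3 : ∀ l : Fin N, l.1 < L →
      ∑ s : Fin N, ζ ^ (l.1 * s.1) • f s = (N : ℂ) • (V ^ l.1) y := by
    intro l hl
    have e1 : ∀ s : Fin N, ζ ^ (l.1 * s.1) • f s = ∑ a ∈ Finset.range M, ∑ n : Fin N,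
        (ζ ^ (s.1 * (l.1 + a)) * ζ⁻¹ ^ (s.1 * n.1)) • A a ((V ^ n.1) x) := by
      intro s
      simp only [hf, hξ, Finset.smul_sum, map_sum, map_smul, smul_smul]
      refine Finset.sum_congr rfl fun a _ => Finset.sum_congr rfl fun n _ => ?_
      congr 1
      ring
    simp only [e1]
    rw [Finset.sum_comm, hy, map_sum, Finset.smul_sum]
    refine Finset.sum_congr rfl fun a ha => ?_
    rw [Finset.mem_range] at ha
    rw [Finset.sum_comm]
    simp only [← Finset.sum_smul]
    have hla : l.1 + a < N := by omega
    rw [Finset.sum_eq_single (⟨l.1 + a, hla⟩ : Fin N)]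
    · rw [sum_pow_mul_inv_pow hζ hla hla, if_pos rfl, ← hcommpow, pow_add]
      rfl
    · intro n _ hne
      rw [sum_pow_mul_inv_pow hζ hla n.2, if_neg, zero_smul]
      exact fun h => hne (Fin.ext h.symm)
    · simp
  have h4 : (L : ℝ) * (N ^ 2 * ‖y‖ ^ 2)
      ≤ ∑ l : Fin N, ‖∑ s : Fin N, ζ ^ (l.1 * s.1) • f s‖ ^ 2 := by
    have hinj : Function.Injective (Fin.castLE (show L ≤ N by omega)) := Fin.castLE_injective _
    calc (L : ℝ) * (N ^ 2 * ‖y‖ ^ 2)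
        = ∑ l : Fin L,
          ‖∑ s : Fin N, ζ ^ ((Fin.castLE (show L ≤ N by omega) l).1 * s.1) • f s‖ ^ 2 := by
          rw [Finset.sum_congr rfl fun l _ => by
            rw [h3 _ (by simp), norm_smul, LinearIsometry.norm_map, mul_pow]]
          simp
      _ = ∑ l ∈ Finset.univ.map ⟨_, hinj⟩, ‖∑ s : Fin N, ζ ^ (l.1 * s.1) • f s‖ ^ 2 := by
          rw [Finset.sum_map]
          rfl
      _ ≤ _ := Finset.sum_le_sum_of_subset_of_nonneg (Finset.subset_univ _)
          fun _ _ _ => by positivity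
  rw [sum_norm_sq_dft hN hζ] at h4
  have h5 : ∑ s, ‖f s‖ ^ 2 ≤ C ^ 2 * (N * (N * ‖x‖ ^ 2)) := by
    rw [← h1, Finset.mul_sum]
    exact Finset.sum_le_sum fun s _ => h2 s
  have hNpos : (0 : ℝ) < N := by positivity
  have h6 : (N : ℝ) ^ 2 * (L * ‖y‖ ^ 2) ≤ N ^ 2 * (N * (C ^ 2 * ‖x‖ ^ 2)) := by
    nlinarith
  have h7 := le_of_mul_le_mul_left h6 (by positivity)
  rw [hNdef] at h7
  exact_mod_cast h7

/-- A von Neumann type inequality: an operator polynomial whose coefficients commute with an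
isometry is bounded, at that isometry, by its supremum over the unit circle. -/
theorem norm_sum_isometry_pow_le (V : X →ₗᵢ[ℂ] X) {M : ℕ} (A : ℕ → X →ₗ[ℂ] X)
    (hcomm : ∀ a x, A a (V x) = V (A a x)) {C : ℝ} (hC : 0 ≤ C)
    (hb : ∀ ω : ℂ, ‖ω‖ = 1 → ∀ x, ‖∑ a ∈ Finset.range M, ω ^ a • A a x‖ ≤ C * ‖x‖) (x : X) :
    ‖∑ a ∈ Finset.range M, A a ((V ^ a) x)‖ ≤ C * ‖x‖ := by
  rw [← sq_le_sq₀ (norm_nonneg _) (by positivity), mul_pow]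
  by_contra! hlt
  -- For a long window the boundary loss is negligible against any excess of `‖y‖²` over `C² ‖x‖²`.
  obtain ⟨L, hL⟩ := exists_nat_gt (M * (C ^ 2 * ‖x‖ ^ 2) /
    (‖∑ a ∈ Finset.range M, A a ((V ^ a) x)‖ ^ 2 - C ^ 2 * ‖x‖ ^ 2))
  rw [div_lt_iff₀ (sub_pos.2 hlt)] at hL
  have := isometry_window_bound V A hcomm hb x L
  linarith

end Isometry

end BallHom

namespace BallHom

/-! ### The matrix-valued von Neumann inequality for two commuting isometries -/

section CommutingIsometries

variable {K : Type*} [NormedAddCommGroup K] [InnerProductSpace ℂ K] {k : ℕ}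

/-- The diagonal action of an isometry on tuples. -/
noncomputable def diagIsometry (k : ℕ) (V : K →ₗᵢ[ℂ] K) :
    PiLp 2 (fun _ : Fin k => K) →ₗᵢ[ℂ] PiLp 2 (fun _ : Fin k => K) where
  toFun x := WithLp.toLp 2 fun i => V (x i)
  map_add' x y := by ext i; simp
  map_smul' c x := by ext i; simp
  norm_map' x := by
    have : ∀ y : PiLp 2 (fun _ : Fin k => K), ‖y‖ = √(∑ i, ‖y i‖ ^ 2) := PiLp.norm_eq_of_L2
    simp [this]

@[simp]
theorem diagIsometry_apply (V : K →ₗᵢ[ℂ] K) (x : PiLp 2 (fun _ : Fin k => K)) (i : Fin k) :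
    diagIsometry k V x i = V (x i) := rfl

theorem diagIsometry_pow_apply (V : K →ₗᵢ[ℂ] K) (n : ℕ) (x : PiLp 2 (fun _ : Fin k => K))
    (i : Fin k) : (diagIsometry k V ^ n) x i = (V ^ n) (x i) := by
  induction n generalizing x with
  | zero => simp
  | succ n ih => simp [pow_succ, ih]

/-- The action of scalar matrices on tuples. -/
noncomputable def scalarAct : Matrix (Fin k) (Fin k) ℂ →ₗ[ℂ]
    PiLp 2 (fun _ : Fin k => K) →ₗ[ℂ] PiLp 2 (fun _ : Fin k => K) :=
  LinearMap.mk₂ ℂ (fun M x => WithLp.toLp 2 fun i => ∑ j, M i j • x j)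
    (fun M N x => by ext i; simp [Finset.sum_add_distrib, add_smul])
    (fun c M x => by ext i; simp [Finset.smul_sum, smul_smul])
    (fun M x y => by ext i; simp [Finset.sum_add_distrib])
    (fun c M x => by ext i; simp [Finset.smul_sum, smul_comm c])

@[simp]
theorem scalarAct_apply (M : Matrix (Fin k) (Fin k) ℂ) (x : PiLp 2 (fun _ : Fin k => K))
    (i : Fin k) : scalarAct M x i = ∑ j, M i j • x j := rfl

theorem norm_scalarAct_le {M : Matrix (Fin k) (Fin k) ℂ} {C : ℝ} (hC : 0 ≤ C) (hM : ‖M‖ ≤ C)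
    (x : PiLp 2 (fun _ : Fin k => K)) : ‖scalarAct M x‖ ≤ C * ‖x‖ := by
  rw [← sq_le_sq₀ (norm_nonneg _) (by positivity), mul_pow, PiLp.norm_sq_eq_of_L2,
    PiLp.norm_sq_eq_of_L2]
  exact sum_norm_sq_sum_smul_le M hM fun i => x i

theorem scalarAct_diagIsometry (M : Matrix (Fin k) (Fin k) ℂ) (V : K →ₗᵢ[ℂ] K)
    (x : PiLp 2 (fun _ : Fin k => K)) :
    scalarAct M (diagIsometry k V x) = diagIsometry k V (scalarAct M x) := by
  ext i
  simp

/-- The matrix-valued von Neumann inequality for a pair of commuting isometries. -/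
theorem sum_norm_sq_commuting_isometries_le {V₁ V₂ : K →ₗᵢ[ℂ] K}
    (hV : ∀ x, V₁ (V₂ x) = V₂ (V₁ x)) {M : ℕ} (c : ℕ → ℕ → Matrix (Fin k) (Fin k) ℂ) {C : ℝ}
    (hC : 0 ≤ C)
    (hb : ∀ z w : ℂ, ‖z‖ = 1 → ‖w‖ = 1 →
      ‖∑ a ∈ Finset.range M, ∑ b ∈ Finset.range M, (z ^ a * w ^ b) • c a b‖ ≤ C) (x : Fin k → K) :
    ∑ i, ‖∑ j, ∑ a ∈ Finset.range M, ∑ b ∈ Finset.range M,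
      c a b i j • (V₂ ^ b) ((V₁ ^ a) (x j))‖ ^ 2 ≤ C ^ 2 * ∑ j, ‖x j‖ ^ 2 := by
  set X := PiLp 2 (fun _ : Fin k => K)
  set W₁ := diagIsometry k V₁ with hW₁
  set W₂ := diagIsometry k V₂ with hW₂
  have hW : ∀ x : X, W₁ (W₂ x) = W₂ (W₁ x) := by
    intro x
    ext i
    simp [hW₁, hW₂, hV]
  have hWp : ∀ b (x : X), (W₂ ^ b) (W₁ x) = W₁ ((W₂ ^ b) x) := by
    intro b
    induction b with
    | zero => intro x; simp
    | succ b ih =>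
      intro x
      simp only [pow_succ, LinearIsometry.coe_mul, Function.comp_apply]
      rw [← hW, ih]
  -- The variables are replaced one at a time. For fixed `z` on the circle, scalar matrix
  -- coefficients and `W₂` give `h1`; then `B a`, which contains `W₂` and commutes with `W₁`, serves
  -- as an operator coefficient for `W₁`.
  set B : ℕ → X →ₗ[ℂ] X := fun a =>
    ∑ b ∈ Finset.range M, (scalarAct (c a b)) ∘ₗ (W₂ ^ b).toLinearMap with hB
  have hBx : ∀ a x, B a x = ∑ b ∈ Finset.range M, scalarAct (c a b) ((W₂ ^ b) x) := by
    intro a x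
    simp [hB]
  have h1 : ∀ z : ℂ, ‖z‖ = 1 → ∀ x : X, ‖∑ a ∈ Finset.range M, z ^ a • B a x‖ ≤ C * ‖x‖ := by
    intro z hz x
    have := norm_sum_isometry_pow_le W₂ (M := M)
      (fun b => scalarAct (∑ a ∈ Finset.range M, z ^ a • c a b))
      (fun b x => scalarAct_diagIsometry _ _ _) hC (fun w hw x => by
        have e : ∑ b ∈ Finset.range M, w ^ b • scalarAct (∑ a ∈ Finset.range M, z ^ a • c a b) x
            = scalarAct
              (∑ a ∈ Finset.range M, ∑ b ∈ Finset.range M, (z ^ a * w ^ b) • c a b) x := by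
          simp only [map_sum, map_smul, LinearMap.sum_apply, LinearMap.smul_apply,
            Finset.smul_sum, smul_smul]
          rw [Finset.sum_comm]
          simp only [mul_comm]
        rw [e]
        exact norm_scalarAct_le hC (hb z w hz hw) x) x
    have e : ∑ a ∈ Finset.range M, z ^ a • B a x = ∑ b ∈ Finset.range M,
        scalarAct (∑ a ∈ Finset.range M, z ^ a • c a b) ((W₂ ^ b) x) := by
      simp only [hBx, map_sum, map_smul, LinearMap.sum_apply, LinearMap.smul_apply,
        Finset.smul_sum]
      exact Finset.sum_comm
    rwa [e]
  have h2 := norm_sum_isometry_pow_le W₁ (M := M) B (fun a x => by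
    simp only [hBx, map_sum, hWp]
    exact Finset.sum_congr rfl fun b _ => scalarAct_diagIsometry _ _ _) hC h1 (WithLp.toLp 2 x)
  rw [← sq_le_sq₀ (norm_nonneg _) (by positivity), mul_pow, PiLp.norm_sq_eq_of_L2,
    PiLp.norm_sq_eq_of_L2] at h2
  refine le_of_eq_of_le (Finset.sum_congr rfl fun i _ => ?_) h2
  congr 2
  simp only [hBx, WithLp.ofLp_sum, Finset.sum_apply, scalarAct_apply]
  rw [Finset.sum_comm]
  refine Finset.sum_congr rfl fun a _ => ?_
  rw [Finset.sum_comm]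
  simp only [hW₁, hW₂, diagIsometry_pow_apply]

end CommutingIsometries

end BallHom

namespace BallHom

/-! ### Unitary extension of partial isometries, and defect operators -/

section UnitaryExtension

variable {E : Type*} [NormedAddCommGroup E] [InnerProductSpace ℂ E]

theorem norm_mem_add_sub_orthogonalProjection_sq (L : Submodule ℂ E) [L.HasOrthogonalProjection]
    (l : L) (y : E) : ‖(l : E) + (y - L.orthogonalProjectionOnto y)‖ ^ 2
      = ‖l‖ ^ 2 + ‖y - L.orthogonalProjectionOnto y‖ ^ 2 := by
  have h : inner ℂ (l : E) (y - L.orthogonalProjectionOnto y) = 0 :=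
    (Submodule.mem_orthogonal _ _).1 (L.sub_starProjection_mem_orthogonal y) _ l.2
  have := norm_add_sq_eq_norm_sq_add_norm_sq_of_inner_eq_zero _ _ h
  simpa [sq] using this

theorem orthogonalProjection_mem_add_sub (L : Submodule ℂ E) [L.HasOrthogonalProjection]
    (l : L) (y : E) :
    L.orthogonalProjectionOnto ((l : E) + (y - L.orthogonalProjectionOnto y)) = l := by
  rw [map_add, map_sub, L.orthogonalProjectionOnto_mem_subspace_eq_self,
    L.orthogonalProjectionOnto_mem_subspace_eq_self, sub_self, add_zero]

/-- Two linear maps with the same norms are intertwined by a unitary operator of the doubled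
space. -/
theorem exists_unitary_extension [CompleteSpace E] {H : Type*} [AddCommGroup H] [Module ℂ H]
    (a b : H →ₗ[ℂ] E)
    (hab : ∀ h, ‖b h‖ = ‖a h‖) :
    ∃ u : (E × E) ≃ₗ[ℂ] (E × E),
      (∀ x, ‖(u x).1‖ ^ 2 + ‖(u x).2‖ ^ 2 = ‖x.1‖ ^ 2 + ‖x.2‖ ^ 2) ∧
      ∀ h, u (a h, 0) = (b h, 0) := by
  set L := (LinearMap.range a).topologicalClosure with hL
  set L' := (LinearMap.range b).topologicalClosure with hL'
  have : CompleteSpace L := (Submodule.isClosed_topologicalClosure _).completeSpace_coe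
  have : CompleteSpace L' := (Submodule.isClosed_topologicalClosure _).completeSpace_coe
  set e₁ : H →ₗ[ℂ] L := a.codRestrict L fun h =>
    Submodule.le_topologicalClosure _ (LinearMap.mem_range_self a h) with he₁
  set e₂ : H →ₗ[ℂ] L' := b.codRestrict L' fun h =>
    Submodule.le_topologicalClosure _ (LinearMap.mem_range_self b h) with he₂
  have hd₁ : DenseRange e₁ := by
    intro x
    rw [closure_subtype, ← Set.range_comp]
    exact x.2
  have hd₂ : DenseRange e₂ := by
    intro x
    rw [closure_subtype, ← Set.range_comp]
    exact x.2
  -- Equal norms make `a h ↦ b h` a well-defined isometry between the closures of the ranges.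
  set φ : L ≃ₗᵢ[ℂ] L' := (LinearEquiv.refl ℂ H).extendOfIsometry e₁ e₂ hd₁ hd₂ hab with hφ
  have hφe : ∀ h, φ (e₁ h) = e₂ h := fun h =>
    LinearEquiv.extendOfIsometry_eq (LinearEquiv.refl ℂ H) e₁ e₂ hd₁ hd₂ hab h
  -- The parts in `L` and `L'` are exchanged by `φ` and its inverse; the parts in the orthogonal
  -- complements change places between the two copies of `E`. No comparison of the dimensions of the
  -- complements is needed, which is the reason for doubling the space.
  refine ⟨{ toFun := fun x => ((φ (L.orthogonalProjectionOnto x.1) : E)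
                + (x.2 - L'.orthogonalProjectionOnto x.2),
              (φ.symm (L'.orthogonalProjectionOnto x.2) : E)
                + (x.1 - L.orthogonalProjectionOnto x.1))
            invFun := fun x => ((φ.symm (L'.orthogonalProjectionOnto x.1) : E)
                + (x.2 - L.orthogonalProjectionOnto x.2),
              (φ (L.orthogonalProjectionOnto x.2) : E) + (x.1 - L'.orthogonalProjectionOnto x.1))
            map_add' := fun x y => by
              ext <;> simp <;> abel
            map_smul' := fun c x => by
              ext <;> simp [smul_sub]
            left_inv := fun x => by
              simp only [orthogonalProjection_mem_add_sub, LinearIsometryEquiv.symm_apply_apply,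
                LinearIsometryEquiv.apply_symm_apply]
              ext <;> simp
            right_inv := fun x => by
              simp only [orthogonalProjection_mem_add_sub, LinearIsometryEquiv.symm_apply_apply,
                LinearIsometryEquiv.apply_symm_apply]
              ext <;> simp }, fun x => ?_, fun h => ?_⟩
  · have h1 := norm_mem_add_sub_orthogonalProjection_sq L (L.orthogonalProjectionOnto x.1) x.1
    have h2 := norm_mem_add_sub_orthogonalProjection_sq L' (L'.orthogonalProjectionOnto x.2) x.2
    rw [add_sub_cancel] at h1 h2
    simp only [LinearEquiv.coe_mk, LinearMap.coe_mk, AddHom.coe_mk]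
    rw [norm_mem_add_sub_orthogonalProjection_sq, norm_mem_add_sub_orthogonalProjection_sq, h1, h2,
      φ.norm_map, φ.symm.norm_map]
    ring
  · have h1 : L.orthogonalProjectionOnto (a h) = e₁ h :=
      L.orthogonalProjectionOnto_mem_subspace_eq_self (e₁ h)
    simp only [LinearEquiv.coe_mk, LinearMap.coe_mk, AddHom.coe_mk, h1, hφe, map_zero]
    simp [he₁, he₂]

end UnitaryExtension

section Defect

variable {H : Type*} [NormedAddCommGroup H] [InnerProductSpace ℂ H] [CompleteSpace H]

/-- Since `T* T ≤ 1`, the operator `1 - T* T` factors as `D* D`. -/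
theorem exists_defect {T : H →L[ℂ] H} (hT : ‖T‖ ≤ 1) :
    ∃ D : H →L[ℂ] H, ∀ h, ‖D h‖ ^ 2 = ‖h‖ ^ 2 - ‖T h‖ ^ 2 := by
  have hsq : ∀ (S : H →L[ℂ] H) (h : H), inner ℂ ((star S * S) h) h = ((‖S h‖ ^ 2 : ℝ) : ℂ) := by
    intro S h
    have : (star S * S) h = ContinuousLinearMap.adjoint S (S h) := rfl
    rw [this, ContinuousLinearMap.adjoint_inner_left, inner_self_eq_norm_sq_to_K]
    simp
  have h0 : 0 ≤ 1 - star T * T := by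
    have : ‖star T * T‖ ≤ 1 := by
      rw [CStarRing.norm_star_mul_self]
      exact mul_le_one₀ hT (norm_nonneg _) hT
    rw [sub_nonneg]
    exact (CStarAlgebra.norm_le_one_iff_of_nonneg _ (star_mul_self_nonneg T)).1 this
  obtain ⟨D, hD⟩ := CStarAlgebra.nonneg_iff_eq_star_mul_self.1 h0
  refine ⟨D, fun h => Complex.ofReal_injective ?_⟩
  rw [← hsq, ← hD, Complex.ofReal_sub, ← hsq T]
  rw [sub_apply, inner_sub_left, one_apply_eq_self,
    inner_self_eq_norm_sq_to_K]
  simp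

end Defect

end BallHom

namespace BallHom

/-! ### Ando's dilation of two commuting contractions -/

section Dilation

variable (H : Type*) [NormedAddCommGroup H] [InnerProductSpace ℂ H]

/-- The Hilbert space of the dilation: the direct sum of `H` and of the square summable sequences
with values in `H⁴`. -/
abbrev DilationSpace : Type _ :=
  WithLp 2 (H × lp (fun _ : ℕ => PiLp 2 (fun _ : Fin 4 => H)) 2)

variable {H}

/-- The components of an element of the dilation space. -/
noncomputable def DilationSpace.components : DilationSpace H →ₗ[ℂ] H × (ℕ → Fin 4 → H) where
  toFun x := (x.fst, fun n i => x.snd n i)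
  map_add' _ _ := rfl
  map_smul' _ _ := rfl

theorem DilationSpace.components_injective :
    Function.Injective (DilationSpace.components (H := H)) := by
  intro x y hxy
  have h1 : (components x).1 = (components y).1 := congrArg Prod.fst hxy
  have h2 : x.snd = y.snd := by
    ext n i
    exact congrFun (congrFun (congrArg Prod.snd hxy) n) i
  exact (WithLp.ext_iff 2).2 (Prod.ext h1 h2)

theorem DilationSpace.hasSum_components (x : DilationSpace H) :
    HasSum (fun n => ∑ i, ‖(components x).2 n i‖ ^ 2) (‖x‖ ^ 2 - ‖(components x).1‖ ^ 2) := by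
  have h := lp.hasSum_norm (p := 2) (by norm_num) x.snd
  rw [WithLp.prod_norm_sq_eq_of_L2]
  simp only [ENNReal.toReal_ofNat, Real.rpow_ofNat, PiLp.norm_sq_eq_of_L2] at h
  rw [show (components x).1 = x.fst from rfl, add_sub_cancel_left]
  exact h

theorem DilationSpace.exists_components_eq (r : H × (ℕ → Fin 4 → H))
    (hr : Summable fun n => ∑ i, ‖r.2 n i‖ ^ 2) : ∃ x : DilationSpace H, components x = r := by
  refine ⟨WithLp.toLp 2 (r.1, ⟨fun n => WithLp.toLp 2 (r.2 n), ?_⟩), rfl⟩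
  refine memℓp_gen ?_
  simpa [PiLp.norm_sq_eq_of_L2] using hr

/-- A linear map on components that preserves the total square norm gives an isometry of the
dilation space. -/
theorem DilationSpace.exists_isometry
    (Φ : (H × (ℕ → Fin 4 → H)) →ₗ[ℂ] (H × (ℕ → Fin 4 → H)))
    (hΦ : ∀ r S, HasSum (fun n => ∑ i, ‖r.2 n i‖ ^ 2) S →
      HasSum (fun n => ∑ i, ‖(Φ r).2 n i‖ ^ 2) (‖r.1‖ ^ 2 + S - ‖(Φ r).1‖ ^ 2)) :
    ∃ V : DilationSpace H →ₗᵢ[ℂ] DilationSpace H, ∀ x, components (V x) = Φ (components x) := by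
  have h1 : ∀ x : DilationSpace H, ∃ y : DilationSpace H, components y = Φ (components x) :=
    fun x => exists_components_eq _ (hΦ _ _ (hasSum_components x)).summable
  choose V hV using h1
  refine ⟨{ toFun := V, map_add' := fun x y => ?_, map_smul' := fun c x => ?_,
            norm_map' := fun x => ?_ }, hV⟩
  · apply components_injective
    rw [hV, map_add, map_add, map_add, hV, hV]
  · apply components_injective
    rw [hV, map_smul, map_smul, RingHom.id_apply, map_smul, hV]
  · change ‖V x‖ = ‖x‖
    have h2 := hasSum_components (V x)
    rw [hV] at h2
    have h3 := h2.unique (hΦ _ _ (hasSum_components x))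
    rw [← sq_eq_sq₀ (norm_nonneg _) (norm_nonneg _)]
    linarith

/-- The isometric dilation of a single contraction, on components. -/
noncomputable def shiftDilation (T D : H →L[ℂ] H) :
    (H × (ℕ → Fin 4 → H)) →ₗ[ℂ] (H × (ℕ → Fin 4 → H)) where
  -- Read as one sequence in `H`, the blocks are shifted by two places, with `D h, 0` inserted in
  -- front. Two such maps shift by exactly one block of four.
  toFun r := (T r.1, fun n => match n with
    | 0 => ![D r.1, 0, r.2 0 0, r.2 0 1]
    | n + 1 => ![r.2 n 2, r.2 n 3, r.2 (n + 1) 0, r.2 (n + 1) 1])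
  map_add' r s := by
    refine Prod.ext (map_add _ _ _) ?_
    funext n i
    cases n <;> fin_cases i <;> simp
  map_smul' c r := by
    refine Prod.ext (map_smul _ _ _) ?_
    funext n i
    cases n <;> fin_cases i <;> simp

theorem shiftDilation_apply_fst (T D : H →L[ℂ] H) (r : H × (ℕ → Fin 4 → H)) :
    (shiftDilation T D r).1 = T r.1 := rfl

theorem shiftDilation_apply_zero (T D : H →L[ℂ] H) (r : H × (ℕ → Fin 4 → H)) :
    (shiftDilation T D r).2 0 = ![D r.1, 0, r.2 0 0, r.2 0 1] := rfl

theorem shiftDilation_apply_succ (T D : H →L[ℂ] H) (r : H × (ℕ → Fin 4 → H)) (n : ℕ) :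
    (shiftDilation T D r).2 (n + 1)
      = ![r.2 n 2, r.2 n 3, r.2 (n + 1) 0, r.2 (n + 1) 1] := rfl

theorem exists_shiftDilation_isometry {T D : H →L[ℂ] H}
    (hD : ∀ h, ‖D h‖ ^ 2 = ‖h‖ ^ 2 - ‖T h‖ ^ 2) :
    ∃ W : DilationSpace H →ₗᵢ[ℂ] DilationSpace H,
      ∀ x, DilationSpace.components (W x) = shiftDilation T D (DilationSpace.components x) := by
  refine DilationSpace.exists_isometry _ fun r S hS => ?_
  have hα : Summable fun n => ‖r.2 n 0‖ ^ 2 + ‖r.2 n 1‖ ^ 2 := by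
    refine Summable.of_nonneg_of_le (fun n => by positivity) (fun n => ?_) hS.summable
    rw [Fin.sum_univ_four]
    nlinarith [sq_nonneg ‖r.2 n 2‖, sq_nonneg ‖r.2 n 3‖]
  have hβ : Summable fun n => ‖r.2 n 2‖ ^ 2 + ‖r.2 n 3‖ ^ 2 := by
    refine Summable.of_nonneg_of_le (fun n => by positivity) (fun n => ?_) hS.summable
    rw [Fin.sum_univ_four]
    nlinarith [sq_nonneg ‖r.2 n 0‖, sq_nonneg ‖r.2 n 1‖]
  obtain ⟨a, ha⟩ := hα
  obtain ⟨b, hb⟩ := hβ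
  have hab : a + b = S := by
    refine (ha.add hb).unique ?_
    simpa [Fin.sum_univ_four, add_assoc] using hS
  -- The second half of each block moves to the next block; the freed place in block `0` receives `D
  -- h`, which restores the norm lost from `h` to `T h`.
  set v : ℕ → ℝ := fun n => match n with
    | 0 => ‖D r.1‖ ^ 2
    | n + 1 => ‖r.2 n 2‖ ^ 2 + ‖r.2 n 3‖ ^ 2 with hv
  have hv' : HasSum v (‖D r.1‖ ^ 2 + b) := HasSum.zero_add (f := v) hb
  have := ha.add hv'
  have e : ‖r.1‖ ^ 2 + S - ‖(shiftDilation T D r).1‖ ^ 2 = a + (‖D r.1‖ ^ 2 + b) := by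
    rw [hD, ← hab]
    rw [shiftDilation_apply_fst]
    ring
  rw [e]
  convert this using 2 with n
  cases n <;> simp [shiftDilation_apply_zero, shiftDilation_apply_succ, Fin.sum_univ_four, hv] <;>
    ring

theorem exists_blockwise_isometry (u : (Fin 4 → H) →ₗ[ℂ] (Fin 4 → H))
    (hu : ∀ x, ∑ i, ‖u x i‖ ^ 2 = ∑ i, ‖x i‖ ^ 2) :
    ∃ U : DilationSpace H →ₗᵢ[ℂ] DilationSpace H, ∀ x, DilationSpace.components (U x)
      = ((DilationSpace.components x).1, fun n => u ((DilationSpace.components x).2 n)) := by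
  refine DilationSpace.exists_isometry
    { toFun := fun r => (r.1, fun n => u (r.2 n))
      map_add' := fun r s => by ext <;> simp
      map_smul' := fun c r => by ext <;> simp } fun r S hS => ?_
  simp only [LinearMap.coe_mk, AddHom.coe_mk, hu]
  simpa using hS

/-- Slots `0, 2` carry the given pair and slots `1, 3` the auxiliary copy of `H × H` in which the
unitary extension has room. The zeros inserted by `shiftDilation` keep that copy empty. -/
theorem exists_unitary_fin_four [CompleteSpace H] (a b : H →L[ℂ] H × H)
    (hab : ∀ h, ‖(b h).1‖ ^ 2 + ‖(b h).2‖ ^ 2 = ‖(a h).1‖ ^ 2 + ‖(a h).2‖ ^ 2) :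
    ∃ u : (Fin 4 → H) ≃ₗ[ℂ] (Fin 4 → H), (∀ x, ∑ i, ‖u x i‖ ^ 2 = ∑ i, ‖x i‖ ^ 2) ∧
      ∀ h, u ![(a h).1, 0, (a h).2, 0] = ![(b h).1, 0, (b h).2, 0] := by
  set t : (H × H) ≃ₗ[ℂ] WithLp 2 (H × H) := (WithLp.linearEquiv 2 ℂ (H × H)).symm
  have ht : ∀ x, ‖t x‖ ^ 2 = ‖x.1‖ ^ 2 + ‖x.2‖ ^ 2 := fun x => WithLp.prod_norm_sq_eq_of_L2 _
  obtain ⟨u, hu, hua⟩ := exists_unitary_extension (t.toLinearMap ∘ₗ a.toLinearMap)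
    (t.toLinearMap ∘ₗ b.toLinearMap) (fun h => by
      rw [← sq_eq_sq₀ (norm_nonneg _) (norm_nonneg _)]
      exact (ht _).trans ((hab h).trans (ht _).symm))
  set q : (Fin 4 → H) ≃ₗ[ℂ] WithLp 2 (H × H) × WithLp 2 (H × H) :=
    { toFun := fun x => (t (x 0, x 2), t (x 1, x 3))
      invFun := fun y => ![(t.symm y.1).1, (t.symm y.2).1, (t.symm y.1).2, (t.symm y.2).2]
      map_add' := fun x y => rfl
      map_smul' := fun c x => rfl
      left_inv := fun x => by
        funext i
        fin_cases i <;> rfl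
      right_inv := fun y => rfl } with hq
  have hqn : ∀ x, ‖(q x).1‖ ^ 2 + ‖(q x).2‖ ^ 2 = ∑ i, ‖x i‖ ^ 2 := by
    intro x
    rw [Fin.sum_univ_four]
    change ‖t (x 0, x 2)‖ ^ 2 + ‖t (x 1, x 3)‖ ^ 2 = _
    rw [ht, ht]
    ring
  refine ⟨q.trans (u.trans q.symm), fun x => ?_, fun h => ?_⟩
  · rw [← hqn, ← hqn]
    simp only [LinearEquiv.trans_apply, LinearEquiv.apply_symm_apply]
    exact hu _
  · have h1 : q ![(a h).1, 0, (a h).2, 0] = (t (a h), 0) := rfl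
    have h2 : q ![(b h).1, 0, (b h).2, 0] = (t (b h), 0) := rfl
    rw [LinearEquiv.trans_apply, LinearEquiv.trans_apply, LinearEquiv.symm_apply_eq, h1, h2]
    exact hua h

/-- **Ando's theorem**: two commuting contractions have a commuting isometric dilation. -/
theorem exists_commuting_isometric_dilation [CompleteSpace H] {T₁ T₂ : H →L[ℂ] H}
    (h₁ : ‖T₁‖ ≤ 1) (h₂ : ‖T₂‖ ≤ 1) (hT : ∀ h, T₁ (T₂ h) = T₂ (T₁ h)) :
    ∃ (V₁ V₂ : DilationSpace H →ₗᵢ[ℂ] DilationSpace H),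
      (∀ x, V₁ (V₂ x) = V₂ (V₁ x)) ∧ (∀ x, (V₁ x).fst = T₁ x.fst) ∧
      ∀ x, (V₂ x).fst = T₂ x.fst := by
  obtain ⟨D₁, hD₁⟩ := exists_defect h₁
  obtain ⟨D₂, hD₂⟩ := exists_defect h₂
  -- The first blocks of `W₁ W₂` and `W₂ W₁` are `(D₁ T₂ h, 0, D₂ h, 0)` and `(D₂ T₁ h, 0, D₁ h,
  -- 0)`. Both have squared norm `‖h‖² - ‖T₁ T₂ h‖²`, so a unitary `u` carries one to the other.
  obtain ⟨u, hu, hua⟩ := exists_unitary_fin_four ((D₁ ∘L T₂).prod D₂) ((D₂ ∘L T₁).prod D₁)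
    (fun h => by
      simp only [ContinuousLinearMap.prod_apply, ContinuousLinearMap.comp_apply, hD₁, hD₂, hT]
      ring)
  simp only [ContinuousLinearMap.prod_apply, ContinuousLinearMap.comp_apply] at hua
  obtain ⟨W₁, hW₁⟩ := exists_shiftDilation_isometry hD₁
  obtain ⟨W₂, hW₂⟩ := exists_shiftDilation_isometry hD₂
  obtain ⟨U, hU⟩ := exists_blockwise_isometry u.toLinearMap hu
  obtain ⟨U', hU'⟩ := exists_blockwise_isometry u.symm.toLinearMap (fun x => by
    simpa using (hu (u.symm x)).symm)
  have hUU' : ∀ x, U (U' x) = x := fun x => DilationSpace.components_injective (by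
    rw [hU, hU']
    simp)
  have hU'U : ∀ x, U' (U x) = x := fun x => DilationSpace.components_injective (by
    rw [hU', hU]
    simp)
  -- Block `0` is the choice of `u`; on later blocks both products are the shift by one block, which
  -- commutes with the blockwise `U`.
  have hcomm : ∀ x, U (W₁ (W₂ x)) = W₂ (W₁ (U x)) := by
    intro x
    apply DilationSpace.components_injective
    rw [hU, hW₁, hW₂, hW₂, hW₁, hU]
    refine Prod.ext (hT _) ?_
    funext n
    cases n with
    | zero =>
      refine (hua _).trans ?_
      funext i
      fin_cases i <;> rfl
    | succ n =>
      have e : ∀ (S D S' D' : H →L[ℂ] H) (r : H × (ℕ → Fin 4 → H)),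
          ((shiftDilation S D) ((shiftDilation S' D') r)).2 (n + 1) = r.2 n := by
        intro S D S' D' r
        funext i
        cases n <;> fin_cases i <;> rfl
      simp only [e]
  -- Both products of `U W₁` and `W₂ U⁻¹` equal `W₂ W₁`, and `U` does not touch the component in
  -- `H`.
  refine ⟨U.comp W₁, W₂.comp U', fun x => ?_, fun x => ?_, fun x => ?_⟩
  · change U (W₁ (W₂ (U' x))) = W₂ (U' (U (W₁ x)))
    rw [hcomm, hUU', hU'U]
  · exact (congrArg Prod.fst (hU (W₁ x))).trans (congrArg Prod.fst (hW₁ x))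
  · exact (congrArg Prod.fst (hW₂ (U' x))).trans (congrArg T₂ (congrArg Prod.fst (hU' x)))

end Dilation

end BallHom

namespace BallHom

/-! ### The matrix-valued von Neumann inequality for two commuting contractions -/

section VonNeumann

variable {H : Type*} [NormedAddCommGroup H] [InnerProductSpace ℂ H] [CompleteSpace H] {k : ℕ}

/-- The matrix-valued von Neumann inequality for a pair of commuting contractions. -/
theorem sum_norm_sq_commuting_contractions_le {T₁ T₂ : H →L[ℂ] H} (h₁ : ‖T₁‖ ≤ 1) (h₂ : ‖T₂‖ ≤ 1)
    (hT : ∀ h, T₁ (T₂ h) = T₂ (T₁ h)) {M : ℕ} (c : ℕ → ℕ → Matrix (Fin k) (Fin k) ℂ) {C : ℝ}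
    (hC : 0 ≤ C)
    (hb : ∀ z w : ℂ, ‖z‖ = 1 → ‖w‖ = 1 →
      ‖∑ a ∈ Finset.range M, ∑ b ∈ Finset.range M, (z ^ a * w ^ b) • c a b‖ ≤ C) (x : Fin k → H) :
    ∑ i, ‖∑ j, ∑ a ∈ Finset.range M, ∑ b ∈ Finset.range M,
      c a b i j • (T₂ ^ b) ((T₁ ^ a) (x j))‖ ^ 2 ≤ C ^ 2 * ∑ j, ‖x j‖ ^ 2 := by
  obtain ⟨V₁, V₂, hV, hV₁, hV₂⟩ := exists_commuting_isometric_dilation h₁ h₂ hT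
  -- The `H`-component of `V x` depends only on that of `x`, so powers and products of the
  -- isometries project to those of the contractions.
  have hpow : ∀ {V : DilationSpace H →ₗᵢ[ℂ] DilationSpace H} {T : H →L[ℂ] H},
      (∀ x, (V x).fst = T x.fst) → ∀ (n : ℕ) (x : DilationSpace H),
        ((V ^ n) x).fst = (T ^ n) x.fst := by
    intro V T hVT n
    induction n with
    | zero => intro x; rfl
    | succ n ih =>
      intro x
      rw [pow_succ, pow_succ, LinearIsometry.coe_mul, Function.comp_apply, ih, hVT]
      rfl
  set J : H → DilationSpace H := fun h => WithLp.toLp 2 (h, 0) with hJ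
  have hJn : ∀ h, ‖J h‖ ^ 2 = ‖h‖ ^ 2 := by
    intro h
    rw [WithLp.prod_norm_sq_eq_of_L2]
    simp [hJ]
  have hfst : ∀ y : DilationSpace H, ‖y.fst‖ ^ 2 ≤ ‖y‖ ^ 2 := by
    intro y
    rw [WithLp.prod_norm_sq_eq_of_L2]
    have := sq_nonneg ‖y.snd‖
    linarith
  have h := sum_norm_sq_commuting_isometries_le hV c hC hb fun j => J (x j)
  simp only [hJn] at h
  refine (Finset.sum_le_sum fun i _ => ?_).trans h
  refine le_of_eq_of_le ?_ (hfst _)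
  congr 2
  set π : DilationSpace H →ₗ[ℂ] H := LinearMap.fst ℂ _ _ ∘ₗ (DilationSpace.components (H := H))
  have hπ : ∀ y, π y = y.fst := fun y => rfl
  rw [← hπ]
  simp only [map_sum, map_smul]
  simp only [hπ, hpow hV₁, hpow hV₂]
  rfl

end VonNeumann

/-! ### Polynomial approximation near the closed bidisc -/

section Interpolation

open Filter Topology Metric

/-- The Lagrange basis at the roots of unity. -/
noncomputable def rootBasis (N : ℕ) (ζ : ℂ) (s : ℕ) (z : ℂ) : ℂ :=
  (N : ℂ)⁻¹ * ∑ n : Fin N, ζ⁻¹ ^ (s * n.1) * z ^ n.1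

theorem norm_rootBasis_le {N : ℕ} {ζ : ℂ} (hN : N ≠ 0) (hζ : IsPrimitiveRoot ζ N) (s : ℕ) {z : ℂ}
    (hz : ‖z‖ ≤ 1) : ‖rootBasis N ζ s z‖ ≤ 1 := by
  have hn : ‖ζ‖ = 1 := hζ.norm'_eq_one hN
  have hN0 : (0 : ℝ) < N := by positivity
  rw [rootBasis, norm_mul, norm_inv, Complex.norm_natCast, inv_mul_le_iff₀ hN0, mul_one]
  refine (norm_sum_le _ _).trans ?_
  refine (Finset.sum_le_card_nsmul _ _ 1 fun n _ => ?_).trans (by simp)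
  rw [norm_mul, norm_pow, norm_inv, hn, norm_pow]
  simpa using pow_le_one₀ (norm_nonneg z) hz

theorem sum_polynomial_mul_rootBasis {N : ℕ} {ζ : ℂ} (hN : N ≠ 0) (hζ : IsPrimitiveRoot ζ N)
    (q : ℕ → ℂ) (z : ℂ) :
    ∑ s : Fin N, (∑ n ∈ Finset.range N, q n * (ζ ^ s.1) ^ n) * rootBasis N ζ s z
      = ∑ n ∈ Finset.range N, q n * z ^ n := by
  have hN0 : (N : ℂ) ≠ 0 := by exact_mod_cast hN
  simp only [← Fin.sum_univ_eq_sum_range (fun n => q n * _ ^ n)]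
  have e : ∀ s : Fin N, (∑ n : Fin N, q n * (ζ ^ s.1) ^ n.1) * rootBasis N ζ s z
      = ∑ a : Fin N, ∑ b : Fin N, (N : ℂ)⁻¹ * (q a * z ^ b.1)
        * (ζ ^ (s.1 * a.1) * ζ⁻¹ ^ (s.1 * b.1)) := by
    intro s
    rw [rootBasis, Finset.mul_sum, Finset.sum_mul_sum]
    refine Finset.sum_congr rfl fun a _ => Finset.sum_congr rfl fun b _ => ?_
    rw [pow_mul]
    ring
  simp only [e]
  rw [Finset.sum_comm]
  refine Finset.sum_congr rfl fun a _ => ?_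
  rw [Finset.sum_comm]
  simp only [← Finset.mul_sum, sum_pow_mul_inv_pow hζ a.2 (Fin.is_lt _)]
  rw [Finset.sum_eq_single a]
  · rw [if_pos rfl]
    field_simp
  · intro b _ hb
    rw [if_neg fun h => hb (Fin.ext h.symm), mul_zero]
  · simp

theorem exists_taylor_approx {g : ℂ → ℂ} {ρ C : ℝ} (hρ : 1 < ρ)
    (hg : DiffContOnCl ℂ g (ball 0 ρ)) (hC : ∀ z ∈ sphere (0 : ℂ) ρ, ‖g z‖ ≤ C) :
    ∃ q : ℕ → ℂ, ∀ (N : ℕ) (z : ℂ), ‖z‖ ≤ 1 →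
      ‖(∑ n ∈ Finset.range N, q n * z ^ n) - g z‖ ≤ C * ρ⁻¹ ^ N / (1 - ρ⁻¹) := by
  have hρ0 : 0 < ρ := by linarith
  refine ⟨fun n => (n.factorial : ℂ)⁻¹ * iteratedDeriv n g 0, fun N z hz => ?_⟩
  have hs := Complex.hasSum_taylorSeries_on_ball (r := ρ) (c := 0) (z := z)
    hg.differentiableOn (by simpa using hz.trans_lt hρ)
  refine norm_sub_le_of_geometric_bound_of_hasSum (inv_lt_one_of_one_lt₀ hρ) (fun n => ?_)
    (f := fun n => (n.factorial : ℂ)⁻¹ * iteratedDeriv n g 0 * z ^ n) ?_ N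
  · have h1 := Complex.norm_iteratedDeriv_le_of_forall_mem_sphere_norm_le n hρ0 hg hC
    have hf : (0 : ℝ) < n.factorial := by exact_mod_cast n.factorial_pos
    rw [norm_mul, norm_mul, norm_inv, Complex.norm_natCast, norm_pow]
    calc (n.factorial : ℝ)⁻¹ * ‖iteratedDeriv n g 0‖ * ‖z‖ ^ n
        ≤ (n.factorial : ℝ)⁻¹ * ‖iteratedDeriv n g 0‖ * 1 := by
          gcongr
          exact pow_le_one₀ (norm_nonneg z) hz
      _ ≤ (n.factorial : ℝ)⁻¹ * (n.factorial * C / ρ ^ n) * 1 := by gcongr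
      _ = C * ρ⁻¹ ^ n := by
          rw [inv_pow]
          field_simp
  · convert hs using 2 with n
    simp
    ring

/-- Interpolation at the `N` roots of unity reproduces polynomials of degree below `N`. The Taylor
error enters once at `z` and once at each node, and every basis function is at most `1` on the disc;
hence the factor `N + 1`. -/
theorem norm_sub_interpolation_le {g : ℂ → ℂ} {ρ C : ℝ} (hρ : 1 < ρ)
    (hg : DiffContOnCl ℂ g (ball 0 ρ)) (hC : ∀ z ∈ sphere (0 : ℂ) ρ, ‖g z‖ ≤ C)
    {N : ℕ} {ζ : ℂ} (hN : N ≠ 0) (hζ : IsPrimitiveRoot ζ N) {z : ℂ} (hz : ‖z‖ ≤ 1) :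
    ‖g z - ∑ s : Fin N, g (ζ ^ s.1) * rootBasis N ζ s z‖
      ≤ (N + 1) * (C * ρ⁻¹ ^ N / (1 - ρ⁻¹)) := by
  obtain ⟨q, hq⟩ := exists_taylor_approx hρ hg hC
  have hn : ‖ζ‖ = 1 := hζ.norm'_eq_one hN
  set ε := C * ρ⁻¹ ^ N / (1 - ρ⁻¹)
  set Q : ℂ → ℂ := fun z => ∑ n ∈ Finset.range N, q n * z ^ n with hQ
  have e : g z - ∑ s : Fin N, g (ζ ^ s.1) * rootBasis N ζ s z
      = ∑ s : Fin N, (Q (ζ ^ s.1) - g (ζ ^ s.1)) * rootBasis N ζ s z - (Q z - g z) := by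
    simp only [sub_mul, Finset.sum_sub_distrib]
    rw [hQ, sum_polynomial_mul_rootBasis hN hζ]
    ring
  rw [e]
  calc _ ≤ ‖∑ s : Fin N, (Q (ζ ^ s.1) - g (ζ ^ s.1)) * rootBasis N ζ s z‖ + ‖Q z - g z‖ :=
        norm_sub_le _ _
    _ ≤ N * ε + ε := by
        refine add_le_add ?_ (hq N z hz)
        refine (norm_sum_le _ _).trans ((Finset.sum_le_card_nsmul _ _ ε fun s _ => ?_).trans
          (by simp))
        rw [norm_mul]
        have h1 := hq N (ζ ^ s.1) (by rw [norm_pow, hn, one_pow])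
        calc _ ≤ ε * 1 := mul_le_mul h1 (norm_rootBasis_le hN hζ s hz) (norm_nonneg _)
              ((norm_nonneg _).trans h1)
          _ = ε := mul_one _
    _ = (N + 1) * ε := by ring

/-- Interpolation in each variable uses one-variable estimates only, with total error of order `(N +
1)² ρ⁻ᴺ`. Validity for all large `N` lets finitely many functions share one degree. -/
theorem eventually_exists_polynomial_approx {F : ℂ → ℂ → ℂ} {ρ C : ℝ} (hρ : 1 < ρ)
    (h₁ : ∀ w, ‖w‖ ≤ 1 → DiffContOnCl ℂ (fun z => F z w) (ball 0 ρ))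
    (h₂ : ∀ z, ‖z‖ ≤ 1 → DiffContOnCl ℂ (F z) (ball 0 ρ))
    (hC : ∀ z w, ‖z‖ ≤ ρ → ‖w‖ ≤ ρ → ‖F z w‖ ≤ C) {ε : ℝ} (hε : 0 < ε) :
    ∀ᶠ N : ℕ in atTop, ∃ c : ℕ → ℕ → ℂ, ∀ z w, ‖z‖ ≤ 1 → ‖w‖ ≤ 1 →
      ‖F z w - ∑ a ∈ Finset.range N, ∑ b ∈ Finset.range N, (z ^ a * w ^ b) * c a b‖ ≤ ε := by
  have hlim : Tendsto (fun N : ℕ => ((N : ℝ) + 1) * ((N + 1) * (C * ρ⁻¹ ^ N / (1 - ρ⁻¹)))) atTop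
      (𝓝 0) := by
    have h := (tendsto_pow_const_mul_const_pow_of_abs_lt_one 2 (r := ρ⁻¹) (by
      rw [abs_of_pos (by positivity)]
      exact inv_lt_one_of_one_lt₀ hρ)).comp (tendsto_add_atTop_nat 1)
    have h2 := h.const_mul (C * ρ / (1 - ρ⁻¹))
    rw [mul_zero] at h2
    refine h2.congr fun N => ?_
    simp only [Function.comp_apply]
    push_cast
    rw [pow_succ ρ⁻¹]
    have : ρ ≠ 0 := by positivity
    field_simp
  filter_upwards [hlim.eventually_le_const hε, eventually_ne_atTop 0] with N hle hN
  set ζ := Complex.exp (2 * Real.pi * Complex.I / N)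
  have hζ : IsPrimitiveRoot ζ N := Complex.isPrimitiveRoot_exp N hN
  have hn : ‖ζ‖ = 1 := hζ.norm'_eq_one hN
  set δ := (N + 1) * (C * ρ⁻¹ ^ N / (1 - ρ⁻¹))
  -- The coefficients are the double discrete Fourier transform of the values of `F` on the grid of
  -- roots of unity.
  refine ⟨fun a b => (N : ℂ)⁻¹ * (N : ℂ)⁻¹ * ∑ s : Fin N, ∑ t : Fin N,
    F (ζ ^ s.1) (ζ ^ t.1) * ζ⁻¹ ^ (s.1 * a) * ζ⁻¹ ^ (t.1 * b), fun z w hz hw => ?_⟩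
  have e1 : ∑ a ∈ Finset.range N, ∑ b ∈ Finset.range N, (z ^ a * w ^ b) *
      ((N : ℂ)⁻¹ * (N : ℂ)⁻¹ * ∑ s : Fin N, ∑ t : Fin N,
        F (ζ ^ s.1) (ζ ^ t.1) * ζ⁻¹ ^ (s.1 * a) * ζ⁻¹ ^ (t.1 * b))
      = ∑ s : Fin N, (∑ t : Fin N, F (ζ ^ s.1) (ζ ^ t.1) * rootBasis N ζ t w)
        * rootBasis N ζ s z := by
    have h1 : ∀ s : Fin N, (∑ t : Fin N, F (ζ ^ s.1) (ζ ^ t.1) * rootBasis N ζ t w)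
        * rootBasis N ζ s z = ∑ a : Fin N, ∑ b : Fin N, ∑ t : Fin N, (z ^ a.1 * w ^ b.1) *
          ((N : ℂ)⁻¹ * (N : ℂ)⁻¹ *
            (F (ζ ^ s.1) (ζ ^ t.1) * ζ⁻¹ ^ (s.1 * a.1) * ζ⁻¹ ^ (t.1 * b.1))) := by
      intro s
      rw [mul_comm, rootBasis, mul_assoc, Finset.sum_mul, Finset.mul_sum]
      refine Finset.sum_congr rfl fun a _ => ?_
      rw [Finset.sum_comm, Finset.mul_sum, Finset.mul_sum]
      refine Finset.sum_congr rfl fun t _ => ?_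
      rw [rootBasis, Finset.mul_sum, Finset.mul_sum, Finset.mul_sum, Finset.mul_sum]
      exact Finset.sum_congr rfl fun b _ => by ring
    simp only [h1, Finset.sum_range, Finset.mul_sum]
    exact (Finset.sum_congr rfl fun a _ => Finset.sum_comm).trans Finset.sum_comm
  rw [e1]
  have e2 : F z w - ∑ s : Fin N, (∑ t : Fin N, F (ζ ^ s.1) (ζ ^ t.1) * rootBasis N ζ t w)
        * rootBasis N ζ s z = (F z w - ∑ s : Fin N, F (ζ ^ s.1) w * rootBasis N ζ s z)
        + ∑ s : Fin N, (F (ζ ^ s.1) w - ∑ t : Fin N, F (ζ ^ s.1) (ζ ^ t.1) * rootBasis N ζ t w)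
          * rootBasis N ζ s z := by
    simp only [sub_mul, Finset.sum_sub_distrib]
    ring
  rw [e2]
  have hroot : ∀ s : ℕ, ‖ζ ^ s‖ ≤ 1 := fun s => by rw [norm_pow, hn, one_pow]
  refine le_trans ?_ hle
  calc _ ≤ δ + N * δ := by
        refine (norm_add_le _ _).trans (add_le_add ?_ ?_)
        · exact norm_sub_interpolation_le (g := fun z => F z w) hρ (h₁ w hw)
            (fun z hz => hC z w (by simpa using hz.le) (hw.trans hρ.le)) hN hζ hz
        · refine (norm_sum_le _ _).trans ((Finset.sum_le_card_nsmul _ _ δ fun s _ => ?_).trans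
            (by simp))
          rw [norm_mul]
          have h3 := norm_sub_interpolation_le (g := F (ζ ^ s.1)) hρ (h₂ _ (hroot _))
            (fun w hw => hC _ w ((hroot _).trans hρ.le) (by simpa using hw.le)) hN hζ hw
          calc _ ≤ δ * 1 := mul_le_mul h3 (norm_rootBasis_le hN hζ s hz) (norm_nonneg _)
                ((norm_nonneg _).trans h3)
            _ = δ := mul_one _
    _ = (N + 1) * δ := by ring

/-- Functions holomorphic near the closed bidisc are uniform limits of polynomials there. -/
theorem eventually_exists_polynomial_approx_of_differentiableOn {f : (Fin 2 → ℂ) → ℂ}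
    {U : Set (Fin 2 → ℂ)} (hU : IsOpen U) (hUs : closedBall (0 : Fin 2 → ℂ) 1 ⊆ U)
    (hf : DifferentiableOn ℂ f U) {ε : ℝ} (hε : 0 < ε) :
    ∀ᶠ N : ℕ in atTop, ∃ c : ℕ → ℕ → ℂ, ∀ z : Fin 2 → ℂ, ‖z‖ ≤ 1 →
      ‖f z - ∑ a ∈ Finset.range N, ∑ b ∈ Finset.range N, (z 0 ^ a * z 1 ^ b) * c a b‖ ≤ ε := by
  -- Compactness leaves room for a closed polydisc of radius `ρ = 1 + δ` inside `U`.
  obtain ⟨δ, hδ, hδU⟩ := (isCompact_closedBall (0 : Fin 2 → ℂ) 1).exists_cthickening_subset_open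
    hU hUs
  rw [cthickening_closedBall hδ.le zero_le_one] at hδU
  set ρ := δ + 1 with hρ
  have hρ1 : 1 < ρ := by linarith
  obtain ⟨C, hC⟩ := (isCompact_closedBall (0 : Fin 2 → ℂ) ρ).exists_bound_of_continuousOn
    (hf.continuousOn.mono hδU)
  have hmem : ∀ z w : ℂ, ‖z‖ ≤ ρ → ‖w‖ ≤ ρ → ![z, w] ∈ closedBall (0 : Fin 2 → ℂ) ρ := by
    intro z w hz hw
    rw [mem_closedBall_zero_iff, pi_norm_le_iff_of_nonneg (by linarith)]
    intro i
    fin_cases i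
    · exact hz
    · exact hw
  have h := eventually_exists_polynomial_approx (F := fun z w => f ![z, w]) (C := C) hρ1
    (fun w hw => by
      have hd : Differentiable ℂ fun z : ℂ => ![z, w] := by
        rw [differentiable_pi]
        intro i
        fin_cases i <;> simp
      refine DifferentiableOn.diffContOnCl ?_
      refine hf.comp hd.differentiableOn fun z hz => hδU (hmem z w ?_ (hw.trans hρ1.le))
      simpa using closure_ball_subset_closedBall hz)
    (fun z hz => by
      have hd : Differentiable ℂ fun w : ℂ => ![z, w] := by
        rw [differentiable_pi]
        intro i
        fin_cases i <;> simp
      refine DifferentiableOn.diffContOnCl ?_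
      refine hf.comp hd.differentiableOn fun w hw => hδU (hmem z w (hz.trans hρ1.le) ?_)
      simpa using closure_ball_subset_closedBall hw)
    (fun z w hz hw => hC _ (hmem z w hz hw)) hε
  filter_upwards [h] with N hN
  obtain ⟨c, hc⟩ := hN
  refine ⟨c, fun z hz => ?_⟩
  have := hc (z 0) (z 1) ((norm_le_pi_norm z 0).trans hz) ((norm_le_pi_norm z 1).trans hz)
  have e : ![z 0, z 1] = z := by
    funext i
    fin_cases i <;> rfl
  rwa [e] at this

end Interpolation

end BallHom

namespace BallHom

/-! ### Contractive homomorphisms over the bidisc -/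

section Bidisc

open Filter Metric

variable {A : Fin 2 → Matrix (Fin 2) (Fin 2) ℂ}

/-- For a linearly independent, simultaneously diagonalizable pair, `‖·‖_A` is the maximum norm in
suitable linear coordinates. -/
theorem exists_linearEquiv_normA_eq (hI : LinearIndependent ℂ A)
    (hD : SimultaneouslyDiagonalizable A) :
    ∃ e : (Fin 2 → ℂ) ≃ₗ[ℂ] (Fin 2 → ℂ), ∀ z, normA A z = ‖e z‖ := by
  obtain ⟨U, hU, W, hW, hd⟩ := hD
  set M : Matrix (Fin 2) (Fin 2) ℂ := Matrix.of fun i l => (U * A l * W) i i with hM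
  have hn : ∀ z, normA A z = ‖M.mulVecLin z‖ := by
    intro z
    have e : U * (∑ l, z l • A l) * W = Matrix.diagonal (M.mulVec z) := by
      have e1 : ∀ l, U * A l * W = Matrix.diagonal fun i => M i l := fun l => by
        rw [hM]
        exact (hd l).diagonal_diag.symm
      simp only [Matrix.mul_sum, Matrix.sum_mul, Matrix.mul_smul, Matrix.smul_mul, e1]
      ext i j
      rcases eq_or_ne i j with rfl | hij
      · rw [Matrix.diagonal_apply_eq, Matrix.sum_apply, Matrix.mulVec, dotProduct]
        exact Finset.sum_congr rfl fun l _ => by simp [mul_comm]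
      · simp [Matrix.sum_apply, hij]
    rw [normA, ← norm_unitary_mul_mul_unitary hU hW, e, Matrix.l2_opNorm_diagonal]
    rfl
  have hinj : Function.Injective M.mulVecLin := by
    rw [← LinearMap.ker_eq_bot, LinearMap.ker_eq_bot']
    intro z hz
    have h0 : ∑ l, z l • A l = 0 := by
      rw [← norm_eq_zero]
      exact (hn z).trans (by rw [hz, norm_zero])
    exact funext (Fintype.linearIndependent_iff.1 hI z h0)
  exact ⟨LinearEquiv.ofInjectiveEndo _ hinj, hn⟩

theorem image_bidisc_eq_unitBall {e : (Fin 2 → ℂ) ≃ₗ[ℂ] (Fin 2 → ℂ)}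
    (he : ∀ z, normA A z = ‖e z‖) : e.symm '' {z | ∀ i, ‖z i‖ < 1} = unitBall A := by
  ext z
  rw [LinearEquiv.image_symm_eq_preimage]
  change (∀ i, ‖e z i‖ < 1) ↔ normA A z < 1
  rw [he, pi_norm_lt_iff one_pos]

theorem sum_norm_sq_sum_le {E : Type*} [SeminormedAddCommGroup E] {k : ℕ} {y : Fin k → Fin k → E}
    {r : Fin k → ℝ} {ε : ℝ} (h : ∀ i j, ‖y i j‖ ≤ ε * r j) :
    ∑ i, ‖∑ j, y i j‖ ^ 2 ≤ (k * ε) ^ 2 * ∑ j, r j ^ 2 := by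
  have h1 : ∀ i, ‖∑ j, y i j‖ ^ 2 ≤ k * (ε ^ 2 * ∑ j, r j ^ 2) := by
    intro i
    have h2 : ‖∑ j, y i j‖ ≤ ∑ j, ε * r j := norm_sum_le_of_le _ fun j _ => h i j
    calc ‖∑ j, y i j‖ ^ 2 ≤ (∑ j, ε * r j) ^ 2 := by gcongr
      _ ≤ Finset.univ.card (α := Fin k) * ∑ j, (ε * r j) ^ 2 := sq_sum_le_card_mul_sum_sq
      _ = _ := by simp only [Finset.card_univ, Fintype.card_fin, mul_pow, Finset.mul_sum]
  refine (Finset.sum_le_card_nsmul _ _ _ fun i _ => h1 i).trans (le_of_eq ?_)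
  simp only [Finset.card_univ, Fintype.card_fin, nsmul_eq_mul]
  ring

theorem norm_le_of_forall_norm_apply_le {k : ℕ} (M : Matrix (Fin k) (Fin k) ℂ) {ε : ℝ} (hε : 0 ≤ ε)
    (h : ∀ i j, ‖M i j‖ ≤ ε) : ‖M‖ ≤ k * ε := by
  rw [l2_opNorm_le_iff _ (by positivity)]
  intro x
  refine sum_norm_sq_sum_le (y := fun i j => M i j * x j) fun i j => ?_
  rw [norm_mul]
  exact mul_le_mul_of_nonneg_right (h i j) (norm_nonneg _)

variable {H : Type*} [NormedAddCommGroup H] [InnerProductSpace ℂ H] {k : ℕ}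

theorem norm_blockOp_le_of_forall_norm_apply_le (T : Matrix (Fin k) (Fin k) (H →L[ℂ] H)) {ε : ℝ}
    (hε : 0 ≤ ε) (h : ∀ i j, ‖T i j‖ ≤ ε) : ‖blockOp T‖ ≤ k * ε := by
  rw [norm_blockOp_le_iff _ (by positivity)]
  intro x
  exact sum_norm_sq_sum_le fun i j => (T i j).le_of_opNorm_le (h i j) _

theorem blockOp_add (T S : Matrix (Fin k) (Fin k) (H →L[ℂ] H)) :
    blockOp (T + S) = blockOp T + blockOp S := by
  ext x i
  simp [blockOp_apply, Finset.sum_add_distrib]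

theorem HomContractive.norm_le {ρ : holo A →ₐ[ℂ] (H →L[ℂ] H)} (hρ : HomContractive ρ) {f : holo A}
    {C : ℝ} (hC : 0 ≤ C) (hf : ∀ z ∈ unitBall A, ‖(f : (Fin 2 → ℂ) → ℂ) z‖ ≤ C) : ‖ρ f‖ ≤ C := by
  rw [← ENNReal.ofReal_le_ofReal_iff hC, ofReal_norm]
  refine (hρ f).trans (iSup₂_le fun z hz => ?_)
  rw [← ofReal_norm]
  exact ENNReal.ofReal_le_ofReal (hf z hz)

/-- The polynomial with coefficients `c` in two elements of a commutative algebra. -/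
def polynomialSum {R : Type*} [Semiring R] [Module ℂ R] (N : ℕ) (c : ℕ → ℕ → ℂ) (f g : R) : R :=
  ∑ a ∈ Finset.range N, ∑ b ∈ Finset.range N, c a b • (g ^ b * f ^ a)

theorem polynomialSum_holo_apply (N : ℕ) (c : ℕ → ℕ → ℂ) (f g : holo A) (z : Fin 2 → ℂ) :
    ((polynomialSum N c f g : holo A) : (Fin 2 → ℂ) → ℂ) z
      = ∑ a ∈ Finset.range N, ∑ b ∈ Finset.range N,
        ((f : (Fin 2 → ℂ) → ℂ) z ^ a * (g : (Fin 2 → ℂ) → ℂ) z ^ b) * c a b := by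
  simp only [polynomialSum, AddSubmonoidClass.coe_finsetSum, Finset.sum_apply,
    SetLike.val_smul, Pi.smul_apply, MulMemClass.coe_mul, SubmonoidClass.coe_pow, Pi.mul_apply,
    Pi.pow_apply, smul_eq_mul]
  exact Finset.sum_congr rfl fun a _ => Finset.sum_congr rfl fun b _ => by ring

/-- A polynomial matrix `P` in the coordinates `f 0`, `f 1` is entrywise `ε`-close to `F` on the
ball. The von Neumann inequality for the commuting contractions `ρ (f 0)`, `ρ (f 1)` bounds `ρ(P)`
by `C + k ε`, and contractivity of `ρ` on the entries of `F - P` costs another `k ε`. -/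
theorem norm_blockOp_map_le [CompleteSpace H] {e : (Fin 2 → ℂ) ≃ₗ[ℂ] (Fin 2 → ℂ)}
    (he : ∀ z, normA A z = ‖e z‖) {ρ : holo A →ₐ[ℂ] (H →L[ℂ] H)} (hρ : HomContractive ρ)
    (F : Matrix (Fin k) (Fin k) (holo A)) {C : ℝ} (hC : 0 ≤ C)
    (hF : ∀ z ∈ unitBall A, ‖evalAt F z‖ ≤ C) {ε : ℝ} (hε : 0 < ε) :
    ‖blockOp (F.map ρ)‖ ≤ C + k * ε + k * ε := by
  obtain ⟨U, hU, hAU, hd⟩ := exists_isOpen_differentiableOn F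
  set E : (Fin 2 → ℂ) ≃L[ℂ] (Fin 2 → ℂ) := e.toContinuousLinearEquiv with hE
  have hnorm : ∀ u, normA A (E.symm u) = ‖u‖ := fun u => by
    rw [he]
    exact congrArg norm (E.apply_symm_apply u)
  have hev : ∀ i j, ∀ᶠ N : ℕ in atTop, ∃ c : ℕ → ℕ → ℂ, ∀ u : Fin 2 → ℂ, ‖u‖ ≤ 1 →
      ‖(F i j : (Fin 2 → ℂ) → ℂ) (E.symm u) - ∑ a ∈ Finset.range N, ∑ b ∈ Finset.range N,
        (u 0 ^ a * u 1 ^ b) * c a b‖ ≤ ε := fun i j =>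
    eventually_exists_polynomial_approx_of_differentiableOn (U := E.symm ⁻¹' U)
      (f := fun u => (F i j : (Fin 2 → ℂ) → ℂ) (E.symm u))
      (hU.preimage E.symm.continuous)
      (fun u hu => hAU ((hnorm u).trans_le (mem_closedBall_zero_iff.1 hu)))
      ((hd i j).comp E.symm.differentiable.differentiableOn fun _ h => h) hε
  obtain ⟨N, hN⟩ := (eventually_all.2 fun i => eventually_all.2 (hev i)).exists
  choose c hc using hN
  have hcoord : ∀ i, ∃ f : holo A, ∀ z, (f : (Fin 2 → ℂ) → ℂ) z = e z i := fun i => by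
    refine ⟨linearFunction A fun l => e (Pi.single l 1) i, fun z => ?_⟩
    conv_rhs => rw [← (Pi.basisFun ℂ (Fin 2)).sum_repr z]
    simp [linearFunction]
  choose f hf using hcoord
  have hT : ∀ i, ‖ρ (f i)‖ ≤ 1 := fun i => hρ.norm_le zero_le_one fun z hz => by
    rw [hf]
    exact (norm_le_pi_norm (e z) i).trans ((he z).symm.trans_le (le_of_lt hz))
  set P : Matrix (Fin k) (Fin k) (holo A) :=
    Matrix.of fun i j => polynomialSum N (c i j) (f 0) (f 1) with hP
  have hPF : ∀ i j, ∀ z ∈ unitBall A,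
      ‖((F - P) i j : (Fin 2 → ℂ) → ℂ) z‖ ≤ ε := by
    intro i j z hz
    have h1 := hc i j (E z) (by
      have := hnorm (E z)
      rw [E.symm_apply_apply] at this
      rw [← this]
      exact le_of_lt hz)
    rw [E.symm_apply_apply] at h1
    simp only [hP, Matrix.sub_apply, Matrix.of_apply, AddSubgroupClass.coe_sub, Pi.sub_apply,
      polynomialSum_holo_apply, hf]
    exact h1
  have h1 : ‖blockOp ((F - P).map ρ)‖ ≤ k * ε :=
    norm_blockOp_le_of_forall_norm_apply_le _ hε.le fun i j => hρ.norm_le hε.le (hPF i j)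
  have hPball : ∀ z ∈ unitBall A, ‖evalAt P z‖ ≤ C + k * ε := by
    intro z hz
    have h2 : evalAt P z = evalAt F z - evalAt (F - P) z := by
      ext i j
      simp [evalAt]
    rw [h2]
    exact (norm_sub_le _ _).trans (add_le_add (hF z hz)
      (norm_le_of_forall_norm_apply_le _ hε.le fun i j => hPF i j z hz))
  set G : (Fin 2 → ℂ) → Matrix (Fin k) (Fin k) ℂ := fun u =>
    ∑ a ∈ Finset.range N, ∑ b ∈ Finset.range N,
      (u 0 ^ a * u 1 ^ b) • Matrix.of fun i j => c i j a b with hG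
  -- The hypothesis concerns the open ball, but the von Neumann inequality is tested on the torus;
  -- continuity of the polynomial closes the gap.
  have hGball : ∀ u, ‖u‖ ≤ 1 → ‖G u‖ ≤ C + k * ε := by
    have hcont : Continuous fun u => ‖G u‖ := by fun_prop
    have hsub : ball (0 : Fin 2 → ℂ) 1 ⊆ {u | ‖G u‖ ≤ C + k * ε} := by
      intro u hu
      have h2 : G u = evalAt P (E.symm u) := by
        ext i j
        have h3 : e (E.symm u) = u := E.apply_symm_apply u
        simp [hG, hP, evalAt, Matrix.sum_apply, polynomialSum_holo_apply, hf, h3]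
      change ‖G u‖ ≤ _
      rw [h2]
      exact hPball _ ((hnorm u).trans_lt (mem_ball_zero_iff.1 hu))
    intro u hu
    have h4 := closure_minimal hsub (isClosed_le hcont continuous_const)
    rw [closure_ball _ one_ne_zero] at h4
    exact h4 (mem_closedBall_zero_iff.2 hu)
  have h2 : ‖blockOp (P.map ρ)‖ ≤ C + k * ε := by
    rw [norm_blockOp_le_iff _ (by positivity)]
    intro x
    have hvN := sum_norm_sq_commuting_contractions_le (hT 0) (hT 1) (fun h => by
        change (ρ (f 0) * ρ (f 1)) h = (ρ (f 1) * ρ (f 0)) h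
        rw [← map_mul, mul_comm, map_mul])
      (M := N) (C := C + k * ε) (fun a b => Matrix.of fun i j => c i j a b) (by positivity)
      (fun z w hz hw => hGball ![z, w] ((pi_norm_le_iff_of_nonneg zero_le_one).2 fun i => by
        fin_cases i
        · exact hz.le
        · exact hw.le)) x
    refine le_of_eq_of_le (Finset.sum_congr rfl fun i _ => ?_) hvN
    congr 2
    refine Finset.sum_congr rfl fun j _ => ?_
    simp [hP, polynomialSum]
  have h3 : F.map ρ = P.map ρ + (F - P).map ρ := by
    ext1 i j
    simp
  rw [h3, blockOp_add]
  exact (norm_add_le _ _).trans (add_le_add h2 h1)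

/-- Contractive homomorphisms are completely contractive when `Ω_A` is linearly a bidisc. -/
theorem HomContractive.homCompletelyContractive [CompleteSpace H]
    {e : (Fin 2 → ℂ) ≃ₗ[ℂ] (Fin 2 → ℂ)} (he : ∀ z, normA A z = ‖e z‖)
    {ρ : holo A →ₐ[ℂ] (H →L[ℂ] H)} (hρ : HomContractive ρ) : HomCompletelyContractive ρ := by
  intro k hk F
  rcases eq_or_ne (supNorm A F) ⊤ with hs | hs
  · rw [hs]
    exact le_top
  have hF : ∀ z ∈ unitBall A, ‖evalAt F z‖ ≤ (supNorm A F).toReal := by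
    intro z hz
    rw [← ENNReal.ofReal_le_iff_le_toReal hs, ofReal_norm]
    exact enorm_evalAt_le_supNorm F hz
  rw [← ofReal_norm, ENNReal.ofReal_le_iff_le_toReal hs]
  refine le_of_forall_pos_le_add fun δ hδ => ?_
  have hk0 : (0 : ℝ) < k := by exact_mod_cast hk
  refine (norm_blockOp_map_le he hρ F ENNReal.toReal_nonneg hF
    (ε := δ / (2 * k)) (by positivity)).trans (le_of_eq ?_)
  field_simp
  ring

end Bidisc

end BallHom

/-! ### Assembly of the three statements -/

theorem mainTheorem1 (A : Fin 2 → Matrix (Fin 2) (Fin 2) ℂ) :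
    -- the pair is not simultaneously diagonalizable
    (¬ BallHom.SimultaneouslyDiagonalizable A →
      ∃ (p q : ℕ) (V : Fin 2 → Matrix (Fin p) (Fin q) ℂ),
        (BallHom.HomContractive (BallHom.rho A V) ∧
          ¬ BallHom.HomCompletelyContractive (BallHom.rho A V)) ∧
        (BallHom.LinContractive A V ∧ ¬ BallHom.LinCompletelyContractive A V)) ∧
    -- `ρ_V` and `L_V` are contractive, and contractive at each matrix level, simultaneously
    (LinearIndependent ℂ A →
      ∀ (p q : ℕ) (V : Fin 2 → Matrix (Fin p) (Fin q) ℂ),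
        (BallHom.HomContractive (BallHom.rho A V) ↔ BallHom.LinContractive A V) ∧
        (∀ k : ℕ, 1 ≤ k →
          (BallHom.HomContractiveAt (BallHom.rho A V) k ↔ BallHom.LinContractiveAt A V k)) ∧
        (BallHom.HomCompletelyContractive (BallHom.rho A V) ↔
          BallHom.LinCompletelyContractive A V)) ∧
    -- the simultaneously diagonalizable case: the bidisc
    (LinearIndependent ℂ A → BallHom.SimultaneouslyDiagonalizable A →
      (∃ T : (Fin 2 → ℂ) ≃ₗ[ℂ] (Fin 2 → ℂ),
        T '' {z | ∀ i, ‖z i‖ < 1} = BallHom.unitBall A) ∧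
      (∀ (H : Type*) [NormedAddCommGroup H] [InnerProductSpace ℂ H] [CompleteSpace H]
        (ρ : BallHom.holo A →ₐ[ℂ] (H →L[ℂ] H)),
          BallHom.HomContractive ρ → BallHom.HomCompletelyContractive ρ) ∧
      (∀ (p q : ℕ) (V : Fin 2 → Matrix (Fin p) (Fin q) ℂ),
        (BallHom.HomContractive (BallHom.rho A V) →
          BallHom.HomCompletelyContractive (BallHom.rho A V)) ∧
        (BallHom.LinContractive A V → BallHom.LinCompletelyContractive A V))) := by
  refine ⟨fun hA => ?_, fun _ p q V => ⟨BallHom.homContractive_rho_iff V,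
    fun k _ => BallHom.homContractiveAt_rho_iff V, BallHom.homCompletelyContractive_rho_iff V⟩,
    fun hI hD => ?_⟩
  -- Matrices of size `1 × 2` suffice, and complete contractivity already fails at `k = 2`.
  · obtain ⟨V, hV, hV2⟩ := BallHom.exists_linContractive_not_linContractiveAt hA
    have h : ¬ BallHom.LinCompletelyContractive A V := fun h => hV2 (h 2 one_le_two)
    exact ⟨1, 2, V, ⟨(BallHom.homContractive_rho_iff V).2 hV,
      fun h' => h ((BallHom.homCompletelyContractive_rho_iff V).1 h')⟩, hV, h⟩
  · obtain ⟨e, he⟩ := BallHom.exists_linearEquiv_normA_eq hI hD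
    refine ⟨⟨e.symm, BallHom.image_bidisc_eq_unitBall he⟩,
      fun H _ _ _ ρ hρ => hρ.homCompletelyContractive he, fun p q V => ⟨fun hρ =>
        hρ.homCompletelyContractive he, fun hV => ?_⟩⟩
    exact (BallHom.homCompletelyContractive_rho_iff V).1
      (((BallHom.homContractive_rho_iff V).2 hV).homCompletelyContractive he)
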